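/- **Reduced words.** For a permutation $\pi\in\mathfrak S_n$, $n\ge 0$, let $R(\pi)$ be the set of its reduced words, i.e. the words $i_1i_2\dots i_k$ with letters in $[n-1]$ and $k$ minimal such that $\pi=s_{i_1}s_{i_2}\cdots s_{i_k}$, where $s_i$ exchanges $i$ and $i+1$ and products are compositions of functions (right-most factor first). Let $G_\pi$ be the graph on $R(\pi)$ in which two words are adjacent if one is obtained from the other by a commutation move (exchange adjacent letters $jk$ with $|j-k|>1$) or a long braid move (exchange $j(j+1)j$ and $(j+1)j(j+1)$ on consecutive positions). **Inflation.** For $\alpha\in\mathfrak S_a$ and $\beta\in\mathfrak S_b$, $a,b\ge 0$, let $\pi=21[\alpha,\beta]\in\mathfrak S_{a+b}$ be the permutation with one-line notation $(\alpha_1+b)\cdots(\alpha_a+b)\,\beta_1\cdots\beta_b$. **Words.** Consider words $w=w_1w_2\dots$ in plain letters $j$, underlined letters $\underline j$ and overlined letters $\overline j$. Let $w^{(m)}=w_1\cdots w_m$, and let $N_j(w)$ be the number of plain letters $j$ in $w$. Let $\mathrm{Ballot}_{a,b}$ be the set of rearrangements $x$ of the multiset $\{1^b,2^b,\dots,a^b\}$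 such that $N_j(x^{(m)})\ge N_k(x^{(m)})$ for all $m$ and all $1\le j<k$. Let $f(w)$ be the word obtained from $w$ by replacing each plain letter $w_i=j$ by the plain letter $b-N_j(w^{(i-1)})$ and keeping all underlined and overlined letters. **Vertices.** Let $\underline R(\alpha)$ and $\overline R(\beta)$ be the sets of reduced words of $\alpha$ and $\beta$ with all letters underlined, respectively overlined. Let $V_{\alpha,\beta}$ be the set of all shuffles $w$ of some $x\in\mathrm{Ballot}_{a,b}$, some $u\in\underline R(\alpha)$ and some $v\in\overline R(\beta)$ such that, with $z=f(w)$, 1. if $w_i=\underline j$, then $N_j(w^{(i-1)})=N_{j+1}(w^{(i-1)})$; 2. if $w_i=\overline j$, then $N_j(z^{(i-1)})=N_{j+1}(z^{(i-1)})$. **Edges.** Let $H_{\alpha,\beta}$ be the graph on $V_{\alpha,\beta}$ in which two distinct words are adjacent if one is obtained from the other by one of the following moves on consecutive positions, where $z=f(w)$. 1. Commutation moves, exchanging two adjacent letters: (a) $w_iw_{i+1}=\underline p\,\underline q$ with $|p-q|>1$; (b) $w_iw_{i+1}=\overline p\,\overline q$ with $|p-q|>1$; (c) $w_iw_{i+1}=pq$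 with either $p>q$, or $p<q$ and $N_p(w^{(i-1)})>N_q(w^{(i-1)})$; (d) $w_iw_{i+1}=\underline p\,\overline q$ or $\overline q\,\underline p$, for any $p,q$; (e) $w_iw_{i+1}=\underline p\,q$ or $q\,\underline p$ with $|p-q|>1$ or $p>q$; (f) $z_iz_{i+1}=\overline p\,q$ or $q\,\overline p$ with $|p-q|>1$ or $q<p$ (the exchange is made in $z$). 2. Long braid moves: (a) exchange $\underline p\,\underline{p+1}\,\underline p$ and $\underline{p+1}\,\underline p\,\underline{p+1}$ in $w$; (b) exchange $\overline p\,\overline{p+1}\,\overline p$ and $\overline{p+1}\,\overline p\,\overline{p+1}$ in $w$; (c) exchange $\underline p\,p\,(p+1)$ and $p\,(p+1)\,\underline p$ in $w$; (d) exchange $\overline p\,(p+1)\,p$ and $(p+1)\,p\,\overline p$ in $z$. A move made in $z$ joins $w$ to the word $w'\in V_{\alpha,\beta}$ for which $f(w')$ is the changed word. **The map.** For $w\in V_{\alpha,\beta}$ and $z=f(w)$ let $\psi(w)=r$ be the word of the same length with $$r_i=\begin{cases} j+b-N_j(w^{(i-1)})-1 & \text{if } w_i=j,\\ j+b-N_j(w^{(i-1)})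 & \text{if } w_i=\underline j,\\ j+N_j(z^{(i-1)}) & \text{if } w_i=\overline j.\end{cases}$$ **Theorem.** Let $\alpha\in\mathfrak S_a$, $\beta\in\mathfrak S_b$ and $\pi=21[\alpha,\beta]$. The map $\psi$ is a bijection from $V_{\alpha,\beta}$ onto $R(\pi)$, and it is a graph isomorphism from $H_{\alpha,\beta}$ to $G_\pi$. -/

import Mathlib

namespace Inflation21

/-! Reduced words of permutations and the graph of a permutation -/

/-- The simple reflection `s_i` of the symmetric group on `n` letters (`1 ≤ i ≤ n - 1`), exchanging
the letters `i` and `i + 1`.  The letter `m` of `{1, …, n}` is the element `m - 1` of `Fin n`.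
Outside the range `1 ≤ i ≤ n - 1` the value is irrelevant. -/
def simpleRefl (n i : ℕ) : Equiv.Perm (Fin n) :=
  if h : 1 ≤ i ∧ i < n then Equiv.swap ⟨i - 1, by omega⟩ ⟨i, h.2⟩ else 1

/-- The word `r = i₁ i₂ … i_k` has all its letters in `{1, …, n - 1}` and
`π = s_{i₁} s_{i₂} ⋯ s_{i_k}`. -/
def IsWordOf {n : ℕ} (π : Equiv.Perm (Fin n)) (r : List ℕ) : Prop :=
  (∀ i ∈ r, 1 ≤ i ∧ i < n) ∧ (r.map (simpleRefl n)).prod = π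

/-- The set `R(π)` of reduced words of `π`: the words of minimal length for `π`. -/
def reducedWords {n : ℕ} (π : Equiv.Perm (Fin n)) : Set (List ℕ) :=
  {r | IsWordOf π r ∧ ∀ r', IsWordOf π r' → r.length ≤ r'.length}

/-- `|p - q| > 1`. -/
def Far (p q : ℕ) : Prop := p + 1 < q ∨ q + 1 < p

/-- Commutation move: exchange adjacent letters `j k` with `|j - k| > 1`. -/
def CommMove (r r' : List ℕ) : Prop :=
  ∃ (s t : List ℕ) (j k : ℕ), Far j k ∧ r = s ++ [j, k] ++ t ∧ r' = s ++ [k, j] ++ t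

/-- Long braid move: replace consecutive letters `j (j+1) j` by `(j+1) j (j+1)`. -/
def BraidMove (r r' : List ℕ) : Prop :=
  ∃ (s t : List ℕ) (j : ℕ), r = s ++ [j, j + 1, j] ++ t ∧ r' = s ++ [j + 1, j, j + 1] ++ t

/-- The graph `G_π` on `R(π)`, whose edges are the commutation moves and the long braid moves
(in either direction). -/
def graphG {n : ℕ} (π : Equiv.Perm (Fin n)) : SimpleGraph (reducedWords π) :=
  SimpleGraph.fromRel fun r r' => CommMove r.1 r'.1 ∨ BraidMove r.1 r'.1

/-- The inflation `21[α, β]`.  In one-line notation it is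
`(α₁ + b) (α₂ + b) … (α_a + b) β₁ β₂ … β_b`. -/
def inflation21 {a b : ℕ} (α : Equiv.Perm (Fin a)) (β : Equiv.Perm (Fin b)) :
    Equiv.Perm (Fin (a + b)) :=
  finSumFinEquiv.symm.trans ((Equiv.sumCongr α β).trans
    ((Equiv.sumComm (Fin a) (Fin b)).trans
      (finSumFinEquiv.trans (finCongr (Nat.add_comm b a)))))

theorem inflation21_left {a b : ℕ} (α : Equiv.Perm (Fin a)) (β : Equiv.Perm (Fin b)) (i : Fin a) :
    (inflation21 α β (Fin.castAdd b i) : ℕ) = α i + b := by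
  simp [inflation21, Nat.add_comm]

theorem inflation21_right {a b : ℕ} (α : Equiv.Perm (Fin a)) (β : Equiv.Perm (Fin b))
    (i : Fin b) : (inflation21 α β (Fin.natAdd a i) : ℕ) = β i := by
  simp [inflation21]

/-! Words with plain, underlined and overlined letters -/

/-- A letter: plain `j`, underlined `j` (written `lower j`) or overlined `j` (written `upper j`). -/
inductive Letter : Type
  | plain (j : ℕ) : Letter
  | lower (j : ℕ) : Letter
  | upper (j : ℕ) : Letter
  deriving DecidableEq

open Letter

/-- `N_j(w)`: the number of plain letters `j` in `w`. -/
def N (j : ℕ) (w : List Letter) : ℕ := w.count (plain j)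

/-- The map `f` (for a given `b`): the plain letter `w_i = j` is replaced by the plain letter
`b - N_j(w₁ … w_{i-1})`; underlined and overlined letters are kept.  (Positions of lists are
counted from `0`, so `w.take i` is the part of `w` strictly before position `i`.) -/
def f (b : ℕ) (w : List Letter) : List Letter :=
  w.mapIdx fun i c =>
    match c with
    | plain j => plain (b - N j (w.take i))
    | lower j => lower j
    | upper j => upper j

/-- `x` is a ballot sequence of positive integers: in each prefix, `j` occurs at least as often as
`k` whenever `1 ≤ j < k`. -/
def IsBallot (x : List ℕ) : Prop :=
  (∀ j ∈ x, 1 ≤ j) ∧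
    ∀ j k : ℕ, 1 ≤ j → j < k → ∀ m ≤ x.length, (x.take m).count k ≤ (x.take m).count j

/-- The ballot sequences that are rearrangements of the multiset `{1^b, 2^b, …, a^b}`. -/
def ballot (a b : ℕ) : Set (List ℕ) :=
  {x | IsBallot x ∧ (x : Multiset ℕ) = ∑ i ∈ Finset.Icc 1 a, Multiset.replicate b i}

/-- `IsShuffle x u v w`: the word `w` is a shuffle of the words `x`, `u` and `v`. -/
inductive IsShuffle {A : Type} : List A → List A → List A → List A → Prop
  | nil : IsShuffle [] [] [] []
  | fst {x u v w : List A} (c : A) : IsShuffle x u v w → IsShuffle (c :: x) u v (c :: w)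
  | snd {x u v w : List A} (c : A) : IsShuffle x u v w → IsShuffle x (c :: u) v (c :: w)
  | trd {x u v w : List A} (c : A) : IsShuffle x u v w → IsShuffle x u (c :: v) (c :: w)

/-- The restricted shuffles of a plain word `x`, the underlined word `u` and the overlined
word `v`. -/
def restrictedShuffle (b : ℕ) (x u v : List ℕ) : Set (List Letter) :=
  {w | IsShuffle (x.map plain) (u.map lower) (v.map upper) w ∧
    (∀ i j : ℕ, w[i]? = some (lower j) → N j (w.take i) = N (j + 1) (w.take i)) ∧
    (∀ i j : ℕ, w[i]? = some (upper j) →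
      N j ((f b w).take i) = N (j + 1) ((f b w).take i))}

/-- The vertex set `V_{α,β}`. -/
def vertexSet {a b : ℕ} (α : Equiv.Perm (Fin a)) (β : Equiv.Perm (Fin b)) : Set (List Letter) :=
  ⋃ x ∈ ballot a b, ⋃ u ∈ reducedWords α, ⋃ v ∈ reducedWords β, restrictedShuffle b x u v

/-! The graph `H_{α,β}` -/

/-- The word `w'` arises from `w` by replacing some consecutive letters `p` by the letters `q`. -/
def Replaces (p q w w' : List Letter) : Prop :=
  ∃ s t : List Letter, w = s ++ p ++ t ∧ w' = s ++ q ++ t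

/-- The commutation moves (exchanges of two adjacent letters) from `w` to `w'`. -/
inductive HComm (b : ℕ) (w w' : List Letter) : Prop
  | lowerLower (p q : ℕ) : Far p q →
      Replaces [lower p, lower q] [lower q, lower p] w w' → HComm b w w'
  | upperUpper (p q : ℕ) : Far p q →
      Replaces [upper p, upper q] [upper q, upper p] w w' → HComm b w w'
  | plainPlain (s t : List Letter) (p q : ℕ) : (q < p ∨ (p < q ∧ N q s < N p s)) →
      w = s ++ [plain p, plain q] ++ t → w' = s ++ [plain q, plain p] ++ t → HComm b w w'
  | lowerUpper (p q : ℕ) :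
      Replaces [lower p, upper q] [upper q, lower p] w w' → HComm b w w'
  | lowerPlain (p q : ℕ) : (Far p q ∨ q < p) →
      Replaces [lower p, plain q] [plain q, lower p] w w' → HComm b w w'
  | upperPlain (p q : ℕ) : (Far p q ∨ q < p) →
      Replaces [upper p, plain q] [plain q, upper p] (f b w) (f b w') → HComm b w w'

/-- The long braid moves from `w` to `w'`. -/
inductive HBraid (b : ℕ) (w w' : List Letter) : Prop
  | lowerLower (p : ℕ) :
      Replaces [lower p, lower (p + 1), lower p] [lower (p + 1), lower p, lower (p + 1)] w w' →
      HBraid b w w'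
  | upperUpper (p : ℕ) :
      Replaces [upper p, upper (p + 1), upper p] [upper (p + 1), upper p, upper (p + 1)] w w' →
      HBraid b w w'
  | lowerPlain (p : ℕ) :
      Replaces [lower p, plain p, plain (p + 1)] [plain p, plain (p + 1), lower p] w w' →
      HBraid b w w'
  | upperPlain (p : ℕ) :
      Replaces [upper p, plain (p + 1), plain p] [plain (p + 1), plain p, upper p]
        (f b w) (f b w') →
      HBraid b w w'

/-- The graph `H_{α,β}` on `V_{α,β}`, whose edges are the moves above, in either direction. -/
def graphH {a b : ℕ} (α : Equiv.Perm (Fin a)) (β : Equiv.Perm (Fin b)) :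
    SimpleGraph (vertexSet α β) :=
  SimpleGraph.fromRel fun w w' => HComm b w.1 w'.1 ∨ HBraid b w.1 w'.1

/-- The map `ψ`. On the words of `V_{α,β}` none of the subtractions is truncated: there a plain
letter `j` is preceded by fewer than `b` plain letters `j`. -/
def psi (b : ℕ) (w : List Letter) : List ℕ :=
  w.mapIdx fun i c =>
    match c with
    | plain j => j + b - N j (w.take i) - 1
    | lower j => j + b - N j (w.take i)
    | upper j => j + N j ((f b w).take i)

end Inflation21

namespace Inflation21

/-! Read a word from left to right. Multiplying on the right by `s_i` exchanges the values at
positions `i` and `i+1` of the one-line notation, and a word is reduced exactly when each letter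
exchanges two values standing in increasing order (`mem_reducedWords_iff`). Call the values up to
`b` small and the others large. The small values start on the left and must end on the right. A
letter of a reduced word thus exchanges a small value with the large one on its right, two large
values, or two small values: these are the plain, underlined and overlined letters. Large and small
values are numbered by their order of position, so a plain `j` moves the `j`-th large value one step
to the left, and `f` records instead the number of the small value that it passes.

The `j`-th large value meets the small ones in the order `b, b-1, …`, and the `k`-th small value
meets the large ones in the order `1, 2, …`. The counts of plain letters in `w` and in `f b w`
therefore form a partition and a conjugate one in a box (`ConjugateCounts`), and they determine all
positions, `bigPos` and `smallPos`. The conditions on the letters of `w` say precisely that the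
required values are neighbours (the lemmas `stepOK_lower_iff`, `stepOK_upper_iff`,
`stepOK_plain_iff`).

The large values read in order form the permutation of the underlined word, and the small values
that of the overlined word (`Valid.wordPerm_psi`). Hence ascents and the final product can be
checked on the two parts separately, which gives the bijection. For the edges, `f`, `psi` and
validity see a prefix only through its counts, so a local exchange preserving the counts leaves the
rest of the word intact. A case analysis of the kinds of the values at the positions involved then
matches the moves on both sides. -/

open Equiv

/-! ### Reduced words, inversions and ascents -/

/-- The product of the adjacent transpositions of `ℕ` named by the letters of a word. -/
def wordPerm (r : List ℕ) : Perm ℕ := (r.map fun i => swap i (i + 1)).prod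

@[simp] theorem wordPerm_nil : wordPerm [] = 1 := rfl

@[simp] theorem wordPerm_append (r t : List ℕ) : wordPerm (r ++ t) = wordPerm r * wordPerm t := by
  simp [wordPerm]

@[simp] theorem wordPerm_singleton (i : ℕ) : wordPerm [i] = swap i (i + 1) := by
  simp [wordPerm]

/-- The permutation fixes everything outside of `{1, …, n}`. -/
def FixesOutside (n : ℕ) (σ : Perm ℕ) : Prop := ∀ x, x = 0 ∨ n < x → σ x = x

theorem FixesOutside.mul {n : ℕ} {σ τ : Perm ℕ} (hσ : FixesOutside n σ) (hτ : FixesOutside n τ) :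
    FixesOutside n (σ * τ) := fun x hx => by
  rw [Perm.mul_apply, hτ x hx, hσ x hx]

theorem fixesOutside_swap {n i : ℕ} (hi : 1 ≤ i ∧ i < n) : FixesOutside n (swap i (i + 1)) :=
  fun x hx => swap_apply_of_ne_of_ne (by omega) (by omega)

theorem fixesOutside_wordPerm {n : ℕ} {r : List ℕ} (hr : ∀ i ∈ r, 1 ≤ i ∧ i < n) :
    FixesOutside n (wordPerm r) := by
  induction r using List.reverseRecOn with
  | nil => intro x _; rfl
  | append_singleton r i ih =>
    rw [wordPerm_append, wordPerm_singleton]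
    exact (ih fun j hj => hr j (by simp [hj])).mul (fixesOutside_swap (hr i (by simp)))

theorem FixesOutside.mapsTo {n : ℕ} {σ : Perm ℕ} (hσ : FixesOutside n σ) {x : ℕ}
    (hx : 1 ≤ x ∧ x ≤ n) : 1 ≤ σ x ∧ σ x ≤ n := by
  by_contra h
  have h1 : σ (σ x) = σ x := hσ _ (by omega)
  have h2 := σ.injective h1
  omega

/-- The inversions of a permutation among the letters `1, …, n`. -/
def inversions (n : ℕ) (σ : Perm ℕ) : Finset (ℕ × ℕ) :=
  (Finset.Icc 1 n ×ˢ Finset.Icc 1 n).filter fun x => x.1 < x.2 ∧ σ x.2 < σ x.1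

theorem mem_inversions {n : ℕ} {σ : Perm ℕ} {x y : ℕ} :
    (x, y) ∈ inversions n σ ↔ (1 ≤ x ∧ x ≤ n) ∧ (1 ≤ y ∧ y ≤ n) ∧ x < y ∧ σ y < σ x := by
  simp [inversions, and_assoc]

theorem swap_succ_lt_swap_succ {i x y : ℕ} (h : x < y) (hne : ¬ (x = i ∧ y = i + 1)) :
    swap i (i + 1) x < swap i (i + 1) y := by
  simp only [swap_apply_def]
  split_ifs <;> omega

/-- Exchanging the entries at an ascent carries the old inversions along with the positions and
creates just one new inversion, `(i, i + 1)`. -/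
theorem card_inversions_mul_swap {n i : ℕ} (hi : 1 ≤ i ∧ i < n) {σ : Perm ℕ}
    (h : σ i < σ (i + 1)) :
    (inversions n (σ * swap i (i + 1))).card = (inversions n σ).card + 1 := by
  have hmaps : ∀ {x : ℕ}, 1 ≤ x ∧ x ≤ n →
      1 ≤ swap i (i + 1) x ∧ swap i (i + 1) x ≤ n := fun hx => (fixesOutside_swap hi).mapsTo hx
  have key : inversions n (σ * swap i (i + 1)) =
      insert (i, i + 1) ((inversions n σ).map
        ((swap i (i + 1)).prodCongr (swap i (i + 1))).toEmbedding) := by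
    ext ⟨x, y⟩
    rw [Finset.mem_insert, Finset.mem_map_equiv, mem_inversions]
    have : ((swap i (i + 1)).prodCongr (swap i (i + 1))).symm (x, y) =
        (swap i (i + 1) x, swap i (i + 1) y) := rfl
    rw [this, mem_inversions]
    simp only [Perm.mul_apply, Prod.mk.injEq]
    constructor
    · rintro ⟨hx, hy, hxy, hlt⟩
      by_cases hc : x = i ∧ y = i + 1
      · exact Or.inl hc
      · exact Or.inr ⟨hmaps hx, hmaps hy, swap_succ_lt_swap_succ hxy hc, hlt⟩
    · rintro (⟨rfl, rfl⟩ | ⟨hx, hy, hxy, hlt⟩)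
      · refine ⟨by omega, by omega, by omega, by simpa using h⟩
      · have hx' := hmaps hx
        have hy' := hmaps hy
        rw [swap_apply_self] at hx' hy'
        refine ⟨hx', hy', ?_, hlt⟩
        have hne : ¬ (swap i (i + 1) x = i ∧ swap i (i + 1) y = i + 1) := by
          rintro ⟨h1, h2⟩
          rw [h1, h2] at hlt
          omega
        simpa using swap_succ_lt_swap_succ hxy hne
  rw [key, Finset.card_insert_of_notMem, Finset.card_map]
  rw [Finset.mem_map_equiv]
  have : ((swap i (i + 1)).prodCongr (swap i (i + 1))).symm (i, i + 1) =
        (swap i (i + 1) i, swap i (i + 1) (i + 1)) := rfl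
  rw [this, mem_inversions]
  simp

/-- Each letter of the word exchanges two values that stand in increasing order. -/
def Ascending (r : List ℕ) : Prop :=
  ∀ s i t, r = s ++ i :: t → wordPerm s i < wordPerm s (i + 1)

theorem forall_split_concat {A : Type*} {p : List A → A → Prop} {r : List A} {i : A} :
    (∀ s c t, r ++ [i] = s ++ c :: t → p s c) ↔ (∀ s c t, r = s ++ c :: t → p s c) ∧ p r i := by
  constructor
  · intro h
    exact ⟨fun s c t hr => h s c (t ++ [i]) (by simp [hr]), h r i [] rfl⟩
  · rintro ⟨h1, h2⟩ s c t hr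
    rcases List.eq_nil_or_concat t with rfl | ⟨t', x, rfl⟩
    · obtain ⟨rfl, hx⟩ := List.append_inj' hr rfl
      cases hx
      exact h2
    · have hr' : r ++ [i] = (s ++ c :: t') ++ [x] := by simpa using hr
      exact h1 s c t' (List.append_inj' hr' rfl).1

theorem ascending_nil : Ascending [] := fun s i t h => by simp at h

theorem ascending_concat {r : List ℕ} {i : ℕ} :
    Ascending (r ++ [i]) ↔ Ascending r ∧ wordPerm r i < wordPerm r (i + 1) :=
  forall_split_concat

/-- Each letter changes the number of inversions by one, upwards exactly at an ascent. So the length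
is attained only if no letter descends. -/
theorem card_inversions_wordPerm {n : ℕ} {r : List ℕ} (hr : ∀ i ∈ r, 1 ≤ i ∧ i < n) :
    (inversions n (wordPerm r)).card ≤ r.length ∧
      ((inversions n (wordPerm r)).card = r.length ↔ Ascending r) := by
  induction r using List.reverseRecOn with
  | nil =>
    have : inversions n 1 = ∅ := by
      ext ⟨x, y⟩
      simp only [mem_inversions, Perm.coe_one, id_eq, Finset.notMem_empty, iff_false]
      omega
    simp [this, ascending_nil]
  | append_singleton r i ih =>
    obtain ⟨h1, h2⟩ := ih fun j hj => hr j (by simp [hj])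
    have hi := hr i (by simp)
    rw [ascending_concat, ← h2, wordPerm_append, wordPerm_singleton, List.length_append,
      List.length_singleton]
    rcases lt_trichotomy (wordPerm r i) (wordPerm r (i + 1)) with h | h | h
    · rw [card_inversions_mul_swap hi h]
      omega
    · have := (wordPerm r).injective h
      omega
    -- At a descent the ascent lemma applies to the product after the exchange, since a second
    -- exchange restores `wordPerm r`.
    · have h3 := card_inversions_mul_swap hi (σ := wordPerm r * swap i (i + 1)) (by simpa using h)
      rw [mul_assoc, swap_mul_self, mul_one] at h3
      omega

theorem eq_one_of_forall_lt {σ : Perm ℕ} (h : ∀ i, σ i < σ (i + 1)) : σ = 1 := by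
  have hm : StrictMono σ := strictMono_nat_of_lt_succ h
  ext x
  refine le_antisymm ?_ (hm.le_apply)
  have hm' : StrictMono σ.symm := fun x y hxy => by
    rw [← hm.lt_iff_lt]
    simpa using hxy
  simpa using hm'.le_apply (x := σ x)

/-- Sorting by adjacent exchanges: a permutation with an inversion has an adjacent descent, and
removing it lowers the number of inversions by one. -/
theorem exists_word_of_fixesOutside {n : ℕ} {σ : Perm ℕ} (hσ : FixesOutside n σ) :
    ∃ r : List ℕ, (∀ i ∈ r, 1 ≤ i ∧ i < n) ∧ wordPerm r = σ ∧
      r.length = (inversions n σ).card := by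
  induction hk : (inversions n σ).card generalizing σ with
  | zero =>
    refine ⟨[], by simp, ?_, rfl⟩
    symm
    apply eq_one_of_forall_lt
    intro i
    by_cases hi : 1 ≤ i ∧ i < n
    · by_contra hlt
      have hne : σ i ≠ σ (i + 1) := fun h => by have := σ.injective h; omega
      have : (i, i + 1) ∈ inversions n σ := mem_inversions.2 ⟨by omega, by omega, by omega, by omega⟩
      rw [Finset.card_eq_zero] at hk
      simp [hk] at this
    · by_cases h0 : i = 0
      · subst h0
        rw [hσ 0 (Or.inl rfl)]
        rcases Nat.eq_zero_or_pos (σ (0 + 1)) with h | h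
        · rw [← hσ 0 (Or.inl rfl)] at h
          have := σ.injective h
          omega
        · exact h
      · rw [hσ (i + 1) (by omega)]
        by_cases hin : i = n
        · have := (hσ.mapsTo (x := i) (by omega)).2
          omega
        · rw [hσ i (by omega)]
          omega
  | succ k ih =>
    have hdesc : ∃ i, (1 ≤ i ∧ i < n) ∧ σ (i + 1) < σ i := by
      by_contra! hno
      obtain ⟨⟨x, y⟩, hxy⟩ := Finset.card_pos.1 (show 0 < (inversions n σ).card by omega)
      rw [mem_inversions] at hxy
      obtain ⟨hx, hy, hlt, hinv⟩ := hxy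
      have : ∀ d, x + d ≤ n → σ x ≤ σ (x + d) := by
        intro d
        induction d with
        | zero => simp
        | succ d ihd =>
          intro hd
          exact (ihd (by omega)).trans (hno (x + d) (by omega))
      have h1 := this (y - x) (by omega)
      rw [show x + (y - x) = y by omega] at h1
      omega
    obtain ⟨i, hi, hlt⟩ := hdesc
    have h3 := card_inversions_mul_swap hi (σ := σ * swap i (i + 1)) (by simpa using hlt)
    rw [mul_assoc, swap_mul_self, mul_one] at h3
    obtain ⟨r, hr, hrσ, hlen⟩ := ih (hσ.mul (fixesOutside_swap hi)) (by omega)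
    refine ⟨r ++ [i], ?_, ?_, by simp [hlen]⟩
    · intro j hj
      rcases List.mem_append.1 hj with h | h
      · exact hr j h
      · rw [List.mem_singleton.1 h]
        exact hi
    · rw [wordPerm_append, hrσ, wordPerm_singleton, mul_assoc, swap_mul_self, mul_one]

/-! ### Transfer from `Fin n` to `ℕ` -/

/-- The elements of `Fin n` as the letters `1, …, n`. -/
def finEquivLetters (n : ℕ) : Fin n ≃ {k : ℕ // 1 ≤ k ∧ k ≤ n} where
  toFun i := ⟨i + 1, by omega, by omega⟩
  invFun k := ⟨k.1 - 1, by have := k.2; omega⟩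
  left_inv i := by simp
  right_inv k := by
    have := k.2
    ext
    simp only
    omega

/-- A permutation of `Fin n` as a permutation of `ℕ` that permutes the letters `1, …, n`. -/
def natPerm (n : ℕ) : Perm (Fin n) →* Perm ℕ := Perm.extendDomainHom (finEquivLetters n)

theorem natPerm_injective (n : ℕ) : Function.Injective (natPerm n) :=
  Perm.extendDomainHom_injective _

theorem natPerm_apply {n : ℕ} (π : Perm (Fin n)) (i : Fin n) :
    natPerm n π ((i : ℕ) + 1) = (π i : ℕ) + 1 :=
  Perm.extendDomain_apply_image π (finEquivLetters n) i

theorem fixesOutside_natPerm {n : ℕ} (π : Perm (Fin n)) : FixesOutside n (natPerm n π) :=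
  fun x hx => Perm.extendDomain_apply_not_subtype π (finEquivLetters n) (by omega)

theorem natPerm_simpleRefl {n i : ℕ} (hi : 1 ≤ i ∧ i < n) :
    natPerm n (simpleRefl n i) = swap i (i + 1) := by
  ext x
  by_cases hx : 1 ≤ x ∧ x ≤ n
  · obtain ⟨y, rfl⟩ : ∃ y : Fin n, (y : ℕ) + 1 = x := ⟨⟨x - 1, by omega⟩, by simp; omega⟩
    rw [natPerm_apply, simpleRefl, dif_pos hi]
    simp only [swap_apply_def, Fin.ext_iff]
    split_ifs <;> (try simp only) <;> omega
  · rw [fixesOutside_natPerm _ x (by omega), fixesOutside_swap hi x (by omega)]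

theorem isWordOf_iff {n : ℕ} {π : Perm (Fin n)} {r : List ℕ} :
    IsWordOf π r ↔ (∀ i ∈ r, 1 ≤ i ∧ i < n) ∧ wordPerm r = natPerm n π := by
  refine and_congr_right fun hr => ?_
  rw [← (natPerm_injective n).eq_iff, map_list_prod, List.map_map, wordPerm]
  have : r.map (natPerm n ∘ simpleRefl n) = r.map fun i => swap i (i + 1) :=
    List.map_congr_left fun i hi => natPerm_simpleRefl (hr i hi)
  rw [this]

/-- The minimal length is the number of inversions: it is a lower bound for every word, and sorting
attains it. Minimality thus becomes a condition on each letter and its prefix, suited to induction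
from the right. -/
theorem mem_reducedWords_iff {n : ℕ} {π : Perm (Fin n)} {r : List ℕ} :
    r ∈ reducedWords π ↔
      (∀ i ∈ r, 1 ≤ i ∧ i < n) ∧ wordPerm r = natPerm n π ∧ Ascending r := by
  rw [reducedWords, Set.mem_ofPred_eq, isWordOf_iff, and_assoc]
  refine and_congr_right fun hr => and_congr_right fun hπ => ?_
  have h1 := card_inversions_wordPerm hr
  rw [← h1.2]
  constructor
  · intro hmin
    obtain ⟨r', hr', hσ, hlen⟩ := exists_word_of_fixesOutside (fixesOutside_natPerm π)
    have := hmin r' (isWordOf_iff.2 ⟨hr', hσ⟩)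
    rw [hπ] at h1 ⊢
    omega
  · intro heq r' hr'
    rw [isWordOf_iff] at hr'
    have := (card_inversions_wordPerm hr'.1).1
    rw [hr'.2, ← hπ] at this
    omega

open Letter

/-! The step by step description of `f` and `psi` -/

/-- The letter of `f b (s ++ [c])` that comes from the last letter `c`. -/
def fStep (b : ℕ) (s : List Letter) : Letter → Letter
  | plain j => plain (b - N j s)
  | lower j => lower j
  | upper j => upper j

/-- The letter of `psi b (s ++ [c])` that comes from the last letter `c`. -/
def step (b : ℕ) (s : List Letter) : Letter → ℕ
  | plain j => j + b - N j s - 1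
  | lower j => j + b - N j s
  | upper j => j + N j (f b s)

@[simp] theorem f_nil (b : ℕ) : f b [] = [] := rfl

@[simp] theorem psi_nil (b : ℕ) : psi b [] = [] := rfl

@[simp] theorem length_f (b : ℕ) (w : List Letter) : (f b w).length = w.length := by simp [f]

@[simp] theorem length_psi (b : ℕ) (w : List Letter) : (psi b w).length = w.length := by simp [psi]

theorem f_concat (b : ℕ) (s : List Letter) (c : Letter) :
    f b (s ++ [c]) = f b s ++ [fStep b s c] := by
  rw [f, List.mapIdx_append]
  congr 1
  · refine List.ext_getElem (by simp) fun i h1 h2 => ?_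
    have hi : i ≤ s.length := by simp at h1; omega
    simp [f, List.take_append_of_le_length hi]
  · cases c <;> simp [fStep]

theorem psi_concat (b : ℕ) (s : List Letter) (c : Letter) :
    psi b (s ++ [c]) = psi b s ++ [step b s c] := by
  rw [psi, List.mapIdx_append]
  congr 1
  · refine List.ext_getElem (by simp) fun i h1 h2 => ?_
    have hi : i ≤ s.length := by simp at h1; omega
    have hf : (f b (s ++ [c])).take i = (f b s).take i := by
      rw [f_concat, List.take_append_of_le_length (by simpa using hi)]
    simp [psi, List.take_append_of_le_length hi, hf]
  · have hf : (f b (s ++ [c])).take s.length = f b s := by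
      rw [f_concat, List.take_append_of_le_length (by simp), List.take_of_length_le (by simp)]
    cases c <;> simp [step, hf]

@[simp] theorem N_nil (j : ℕ) : N j [] = 0 := rfl

@[simp] theorem N_append (j : ℕ) (s t : List Letter) : N j (s ++ t) = N j s + N j t :=
  List.count_append

@[simp] theorem N_plain (j p : ℕ) : N j [plain p] = if p = j then 1 else 0 := by
  simp [N, List.count_singleton]

@[simp] theorem N_lower (j p : ℕ) : N j [lower p] = 0 := by simp [N]

@[simp] theorem N_upper (j p : ℕ) : N j [upper p] = 0 := by simp [N]

@[simp] theorem fStep_plain (b : ℕ) (s : List Letter) (p : ℕ) :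
    fStep b s (plain p) = plain (b - N p s) := rfl

@[simp] theorem fStep_lower (b : ℕ) (s : List Letter) (p : ℕ) :
    fStep b s (lower p) = lower p := rfl

@[simp] theorem fStep_upper (b : ℕ) (s : List Letter) (p : ℕ) :
    fStep b s (upper p) = upper p := rfl

/-- The words `s` and `s'` contain each plain letter equally often, and so do their images
under `f b`. -/
def SameCounts (b : ℕ) (s s' : List Letter) : Prop :=
  ∀ j, N j s = N j s' ∧ N j (f b s) = N j (f b s')

theorem SameCounts.fStep_eq {b : ℕ} {s s' : List Letter} (h : SameCounts b s s') (c : Letter) :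
    fStep b s c = fStep b s' c := by
  cases c <;> simp [fStep, (h _).1]

theorem SameCounts.step_eq {b : ℕ} {s s' : List Letter} (h : SameCounts b s s') (c : Letter) :
    step b s c = step b s' c := by
  cases c <;> simp [step, (h _).1, (h _).2]

theorem SameCounts.concat {b : ℕ} {s s' : List Letter} (h : SameCounts b s s') (c : Letter) :
    SameCounts b (s ++ [c]) (s' ++ [c]) := fun j => by
  rw [f_concat, f_concat, h.fStep_eq]
  simp [(h j).1, (h j).2]

theorem sameCounts_concat_lower (b : ℕ) (s : List Letter) (p : ℕ) :
    SameCounts b (s ++ [lower p]) s := fun j => by simp [f_concat]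

theorem sameCounts_concat_upper (b : ℕ) (s : List Letter) (p : ℕ) :
    SameCounts b (s ++ [upper p]) s := fun j => by simp [f_concat]

/-- The part of `f b (s ++ t)` that comes from `t`. -/
def fTail (b : ℕ) : List Letter → List Letter → List Letter
  | _, [] => []
  | s, c :: t => fStep b s c :: fTail b (s ++ [c]) t

/-- The part of `psi b (s ++ t)` that comes from `t`. -/
def psiTail (b : ℕ) : List Letter → List Letter → List ℕ
  | _, [] => []
  | s, c :: t => step b s c :: psiTail b (s ++ [c]) t

theorem f_append (b : ℕ) (s t : List Letter) : f b (s ++ t) = f b s ++ fTail b s t := by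
  induction t generalizing s with
  | nil => simp [fTail]
  | cons c t ih => simpa [fTail, f_concat] using ih (s ++ [c])

theorem psi_append (b : ℕ) (s t : List Letter) : psi b (s ++ t) = psi b s ++ psiTail b s t := by
  induction t generalizing s with
  | nil => simp [psiTail]
  | cons c t ih => simpa [psiTail, psi_concat] using ih (s ++ [c])

theorem SameCounts.fTail_eq {b : ℕ} {s s' : List Letter} (h : SameCounts b s s')
    (t : List Letter) : fTail b s t = fTail b s' t := by
  induction t generalizing s s' with
  | nil => rfl
  | cons c t ih => rw [fTail, fTail, h.fStep_eq, ih (h.concat c)]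

theorem SameCounts.psiTail_eq {b : ℕ} {s s' : List Letter} (h : SameCounts b s s')
    (t : List Letter) : psiTail b s t = psiTail b s' t := by
  induction t generalizing s s' with
  | nil => rfl
  | cons c t ih => rw [psiTail, psiTail, h.step_eq, ih (h.concat c)]

/-! Valid words -/

/-- The letter `c` may follow the word `s`. -/
def StepOK (a b : ℕ) (s : List Letter) : Letter → Prop
  | plain j => (1 ≤ j ∧ j ≤ a) ∧ N j s < b ∧ ∀ k, 1 ≤ k → k < j → N j s < N k s
  | lower j => (1 ≤ j ∧ j < a) ∧ N j s = N (j + 1) s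
  | upper j => (1 ≤ j ∧ j < b) ∧ N j (f b s) = N (j + 1) (f b s)

/-- Each letter of the word may follow the letters before it. -/
def Valid (a b : ℕ) (w : List Letter) : Prop :=
  ∀ s c t, w = s ++ c :: t → StepOK a b s c

theorem valid_nil (a b : ℕ) : Valid a b [] := fun s c t h => by simp at h

theorem valid_concat {a b : ℕ} {s : List Letter} {c : Letter} :
    Valid a b (s ++ [c]) ↔ Valid a b s ∧ StepOK a b s c :=
  forall_split_concat

theorem Valid.left {a b : ℕ} {s t : List Letter} (h : Valid a b (s ++ t)) : Valid a b s :=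
  fun s' c t' hs => h s' c (t' ++ t) (by simp [hs])

theorem SameCounts.stepOK {a b : ℕ} {s s' : List Letter} (h : SameCounts b s s') {c : Letter}
    (hc : StepOK a b s c) : StepOK a b s' c := by
  have h1 : ∀ j, N j s' = N j s := fun j => (h j).1.symm
  have h2 : ∀ j, N j (f b s') = N j (f b s) := fun j => (h j).2.symm
  cases c <;> simpa only [StepOK, h1, h2] using hc

theorem SameCounts.symm {b : ℕ} {s s' : List Letter} (h : SameCounts b s s') :
    SameCounts b s' s := fun j => ⟨(h j).1.symm, (h j).2.symm⟩

/-- Whether a letter may follow depends on the prefix only through its counts, so a tail can be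
moved from one prefix to the other. -/
theorem SameCounts.valid_append {a b : ℕ} {s s' t : List Letter} (h : SameCounts b s s')
    (hs' : Valid a b s') (hv : Valid a b (s ++ t)) : Valid a b (s' ++ t) := by
  induction t generalizing s s' with
  | nil => simpa using hs'
  | cons c t ih =>
    rw [List.append_cons] at hv ⊢
    exact ih (h.concat c) (valid_concat.2 ⟨hs', h.stepOK (valid_concat.1 hv.left).2⟩) hv

/-! ### Conjugate partitions and the positions of the values -/

/-- The position of the `j`-th large value after the word `s`. -/
def bigPos (b : ℕ) (s : List Letter) (j : ℕ) : ℕ := j + b - N j s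

/-- The position of the `k`-th small value after the word `s`. -/
def smallPos (b : ℕ) (s : List Letter) (k : ℕ) : ℕ := k + N k (f b s)

/-- The numbers of plain letters of `s` and `f b s` form a pair of conjugate partitions inside a
box. -/
structure ConjugateCounts (a b : ℕ) (s : List Letter) : Prop where
  le : ∀ j, N j s ≤ b
  anti : ∀ j k, 1 ≤ j → j ≤ k → N k s ≤ N j s
  f_range : ∀ k, N k (f b s) ≠ 0 → 1 ≤ k ∧ k ≤ b
  f_le : ∀ k, N k (f b s) ≤ a
  -- Both sides say that the `j`-th large value has already passed the `k`-th small one.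
  galois : ∀ j k, 1 ≤ j → j ≤ a → 1 ≤ k → k ≤ b → (j ≤ N k (f b s) ↔ b < N j s + k)
  cover : ∀ i, 1 ≤ i → i ≤ a + b → (∃ j, (1 ≤ j ∧ j ≤ a) ∧ bigPos b s j = i) ∨
    ∃ k, (1 ≤ k ∧ k ≤ b) ∧ smallPos b s k = i

theorem conjugateCounts_nil (a b : ℕ) : ConjugateCounts a b [] where
  le := by simp
  anti := by simp
  f_range := by simp
  f_le := by simp
  galois j k := by simp; omega
  cover i h1 h2 := by
    by_cases hi : i ≤ b
    · exact Or.inr ⟨i, ⟨h1, hi⟩, by simp [smallPos]⟩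
    · exact Or.inl ⟨i - b, by omega, by simp [bigPos]; omega⟩

theorem ConjugateCounts.sameCounts {a b : ℕ} {s s' : List Letter} (hs : ConjugateCounts a b s)
    (h : SameCounts b s s') : ConjugateCounts a b s' := by
  have h1 : ∀ j, N j s = N j s' := fun j => (h j).1
  have h2 : ∀ j, N j (f b s) = N j (f b s') := fun j => (h j).2
  obtain ⟨h_1, h_2, h_4, h_5, h_6, h_7⟩ := hs
  simp only [bigPos, smallPos, h1, h2] at *
  exact ⟨h_1, h_2, h_4, h_5, h_6, h_7⟩

/-- Before a plain letter `p`, the number of its exchange partner is `b - N p s`, and this small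
value has been exchanged with the large values before the `p`-th. -/
theorem ConjugateCounts.plain_partner {a b : ℕ} {s : List Letter} (h : ConjugateCounts a b s)
    {p : ℕ} (hp : StepOK a b s (plain p)) : N (b - N p s) (f b s) + 1 = p := by
  obtain ⟨hp1, hpb, hlt⟩ := hp
  have h1 := h.galois p (b - N p s) (by omega) (by omega) (by omega) (by omega)
  rcases Nat.lt_or_ge 1 p with h2 | h2
  · have h3 := h.galois (p - 1) (b - N p s) (by omega) (by omega) (by omega) (by omega)
    have h4 := hlt (p - 1) (by omega) (by omega)
    omega
  · omega

/-- A plain `p` adds a box at a corner of the partition. By `plain_partner` the column count rises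
from `p - 1` to `p`, so in `galois` both sides change only for the pair `(p, b - N p s)`. In `cover`
the two values involved exchange their positions. -/
theorem ConjugateCounts.concat_plain {a b : ℕ} {s : List Letter} (h : ConjugateCounts a b s)
    {p : ℕ} (hp : StepOK a b s (plain p)) : ConjugateCounts a b (s ++ [plain p]) := by
  have hpart := h.plain_partner hp
  obtain ⟨hp1, hpb, hlt⟩ := hp
  have hN : ∀ j, N j (s ++ [plain p]) = N j s + if p = j then 1 else 0 := by simp
  have hD : ∀ k, N k (f b (s ++ [plain p])) = N k (f b s) + if b - N p s = k then 1 else 0 := by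
    simp [f_concat]
  refine ⟨fun j => ?_, fun j k hj hjk => ?_, fun k hk => ?_, fun k => ?_,
    fun j k hj hja hk hkb => ?_, fun i hi hi' => ?_⟩
  · rw [hN]
    have := h.le j
    split_ifs with hj
    · subst hj; omega
    · omega
  · rw [hN, hN]
    have := h.anti j k hj hjk
    by_cases hk : p = k
    · subst hk
      rcases hjk.lt_or_eq with h1 | rfl
      · have := hlt j hj h1
        split_ifs <;> omega
      · simp
    · split_ifs <;> omega
  · rw [hD] at hk
    by_cases hk' : b - N p s = k
    · omega
    · rw [if_neg hk'] at hk
      exact h.f_range k hk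
  · rw [hD]
    have := h.f_le k
    split_ifs with hk
    · subst hk; omega
    · omega
  · rw [hN, hD]
    have h1 := h.galois j k hj hja hk hkb
    by_cases hk : b - N p s = k
    · by_cases hj : p = j
      · subst hk; subst hj; simp; omega
      · rw [if_neg hj, if_pos hk]
        subst hk; omega
    · rw [if_neg hk]
      by_cases hj : p = j
      · subst hj; simp; omega
      · rw [if_neg hj]; omega
  · rcases h.cover i hi hi' with ⟨j, hj, hji⟩ | ⟨k, hk, hki⟩
    · by_cases hjp : p = j
      · refine Or.inr ⟨b - N p s, by omega, ?_⟩
        subst hjp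
        rw [smallPos, hD, if_pos rfl]
        rw [bigPos] at hji
        omega
      · refine Or.inl ⟨j, hj, ?_⟩
        rw [bigPos, hN, if_neg hjp]
        exact hji
    · by_cases hkp : b - N p s = k
      · refine Or.inl ⟨p, hp1, ?_⟩
        rw [bigPos, hN, if_pos rfl]
        rw [smallPos] at hki
        subst hkp
        omega
      · refine Or.inr ⟨k, hk, ?_⟩
        rw [smallPos, hD, if_neg hkp]
        exact hki

theorem Valid.conjugateCounts {a b : ℕ} {w : List Letter} (hw : Valid a b w) :
    ConjugateCounts a b w := by
  induction w using List.reverseRecOn with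
  | nil => exact conjugateCounts_nil a b
  | append_singleton s c ih =>
    obtain ⟨hs, hc⟩ := valid_concat.1 hw
    have h := ih hs
    cases c with
    | plain p => exact h.concat_plain hc
    | lower p => exact h.sameCounts (sameCounts_concat_lower b s p).symm
    | upper p => exact h.sameCounts (sameCounts_concat_upper b s p).symm

/-- Equality of the two counts means that consecutive small values occupy neighbouring positions.
This and the two analogous lemmas below replace the combinatorial side conditions by positions in
all later case analyses. -/
theorem stepOK_upper_iff {a b : ℕ} {s : List Letter} {p i : ℕ} :
    (StepOK a b s (upper p) ∧ step b s (upper p) = i) ↔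
      (1 ≤ p ∧ p < b) ∧ smallPos b s p = i ∧ smallPos b s (p + 1) = i + 1 := by
  simp only [StepOK, step, smallPos]
  omega

namespace ConjugateCounts

variable {a b : ℕ} {s : List Letter}

/-- A partition determines its conjugate: `galois` recovers the counts of `f` from those of the
word. -/
theorem sameCounts_of_N_eq {s' : List Letter} (h : ConjugateCounts a b s)
    (h' : ConjugateCounts a b s') (heq : ∀ j, N j s = N j s') : SameCounts b s s' := by
  have key : ∀ {t t' : List Letter}, ConjugateCounts a b t → ConjugateCounts a b t' →
      (∀ j, N j t = N j t') → ∀ k, N k (f b t) ≤ N k (f b t') := by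
    intro t t' ht ht' hN k
    by_cases h0 : N k (f b t) = 0
    · omega
    · have hk := ht.f_range k h0
      have h1 := ht.galois _ k (by omega) (ht.f_le k) hk.1 hk.2
      have h2 := ht'.galois _ k (by omega) (ht.f_le k) hk.1 hk.2
      rw [h2, ← hN, ← h1]
  exact fun j => ⟨heq j, le_antisymm (key h h' heq j) (key h' h (fun i => (heq i).symm) j)⟩

theorem bigPos_lt (h : ConjugateCounts a b s) {j k : ℕ} (hj : 1 ≤ j) (hjk : j < k) :
    bigPos b s j < bigPos b s k := by
  have h1 := h.anti j k hj hjk.le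
  have h2 := h.le j
  rw [bigPos, bigPos]
  omega

theorem smallPos_lt (h : ConjugateCounts a b s) {j k : ℕ} (hj : 1 ≤ j) (hjk : j < k)
    (hk : k ≤ b) : smallPos b s j < smallPos b s k := by
  rw [smallPos, smallPos]
  by_cases h0 : N j (f b s) = 0
  · omega
  · have h1 := h.galois _ j (by omega) (h.f_le j) hj (by omega)
    have h2 := h.galois _ k (by omega) (h.f_le j) (by omega) hk
    omega

/-- If the large value has passed the small one, then its position is below `j + k` and the other is
at least `j + k`. If it has not, its position is at least `j + k` and the other is below. -/
theorem bigPos_ne_smallPos (h : ConjugateCounts a b s) {j k : ℕ} (hj : 1 ≤ j ∧ j ≤ a)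
    (hk : 1 ≤ k ∧ k ≤ b) : bigPos b s j ≠ smallPos b s k := by
  have h1 := h.galois j k hj.1 hj.2 hk.1 hk.2
  have h2 := h.le j
  rw [bigPos, smallPos]
  omega

theorem bigPos_inj (h : ConjugateCounts a b s) {j k : ℕ} (hj : 1 ≤ j) (hk : 1 ≤ k)
    (heq : bigPos b s j = bigPos b s k) : j = k := by
  rcases lt_trichotomy j k with h1 | h1 | h1
  · have := h.bigPos_lt hj h1; omega
  · exact h1
  · have := h.bigPos_lt hk h1; omega

theorem smallPos_inj (h : ConjugateCounts a b s) {j k : ℕ} (hj : 1 ≤ j ∧ j ≤ b)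
    (hk : 1 ≤ k ∧ k ≤ b) (heq : smallPos b s j = smallPos b s k) : j = k := by
  rcases lt_trichotomy j k with h1 | h1 | h1
  · have := h.smallPos_lt hj.1 h1 hk.2; omega
  · exact h1
  · have := h.smallPos_lt hk.1 h1 hj.2; omega

theorem stepOK_lower_iff (h : ConjugateCounts a b s) {p i : ℕ} :
    (StepOK a b s (lower p) ∧ step b s (lower p) = i) ↔
      (1 ≤ p ∧ p < a) ∧ bigPos b s p = i ∧ bigPos b s (p + 1) = i + 1 := by
  have h1 := h.le p
  have h2 := h.le (p + 1)
  simp only [StepOK, step, bigPos]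
  omega

/-- The plain letter `p` exchanges the `k`-th small value and the `p`-th large value. -/
theorem stepOK_plain_iff (h : ConjugateCounts a b s) {p i k : ℕ} :
    (StepOK a b s (plain p) ∧ step b s (plain p) = i ∧ b - N p s = k) ↔
      (1 ≤ p ∧ p ≤ a) ∧ (1 ≤ k ∧ k ≤ b) ∧ smallPos b s k = i ∧ bigPos b s p = i + 1 := by
  constructor
  · rintro ⟨hp, rfl, rfl⟩
    have h1 := h.plain_partner hp
    obtain ⟨hp1, hpb, -⟩ := hp
    simp only [step, bigPos, smallPos]
    omega
  · rintro ⟨hp, hk, rfl, hb⟩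
    -- The large value stands to the right of the small one and so has not passed it: `k ≤ b - N p
    -- s` and `N k (f b s) ≤ p - 1`. Being neighbours forces equality in both. Every earlier large
    -- value has then passed the `k`-th small one, which is the corner condition.
    have h1 := h.galois p k hp.1 hp.2 hk.1 hk.2
    have h2 := h.le p
    simp only [StepOK, step, bigPos, smallPos] at *
    refine ⟨⟨hp, by omega, fun j hj hjp => ?_⟩, by omega, by omega⟩
    have h3 := h.galois j k hj (by omega) hk.1 hk.2
    omega

end ConjugateCounts

variable {a b : ℕ}

/-! Injectivity of `psi` and `f` on valid words -/

/-- The kinds and numbers of the values at positions `i` and `i + 1` determine the letter, because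
no position holds two values. -/
theorem ConjugateCounts.eq_of_step_eq {s : List Letter} (h : ConjugateCounts a b s)
    {c c' : Letter} (hc : StepOK a b s c) (hc' : StepOK a b s c')
    (heq : step b s c = step b s c') : c = c' := by
  cases c with
  | plain p =>
    obtain ⟨hp, hk, h1, h2⟩ := h.stepOK_plain_iff.1 ⟨hc, heq, rfl⟩
    cases c' with
    | plain q =>
      obtain ⟨hq, -, -, h3⟩ := h.stepOK_plain_iff.1 ⟨hc', rfl, rfl⟩
      rw [h.bigPos_inj hp.1 hq.1 (h2.trans h3.symm)]
    | lower q =>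
      obtain ⟨hq, h3, -⟩ := h.stepOK_lower_iff.1 ⟨hc', rfl⟩
      exact absurd (h3.trans h1.symm) (h.bigPos_ne_smallPos (by omega) hk)
    | upper q =>
      obtain ⟨hq, -, h3⟩ := stepOK_upper_iff.1 ⟨hc', rfl⟩
      exact absurd (h2.trans h3.symm) (h.bigPos_ne_smallPos hp (by omega))
  | lower p =>
    obtain ⟨hp, h1, h2⟩ := h.stepOK_lower_iff.1 ⟨hc, heq⟩
    cases c' with
    | plain q =>
      obtain ⟨-, hk, h3, -⟩ := h.stepOK_plain_iff.1 ⟨hc', rfl, rfl⟩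
      exact absurd (h1.trans h3.symm) (h.bigPos_ne_smallPos (by omega) hk)
    | lower q =>
      obtain ⟨hq, h3, -⟩ := h.stepOK_lower_iff.1 ⟨hc', rfl⟩
      rw [h.bigPos_inj hp.1 hq.1 (h1.trans h3.symm)]
    | upper q =>
      obtain ⟨hq, h3, -⟩ := stepOK_upper_iff.1 ⟨hc', rfl⟩
      exact absurd (h1.trans h3.symm) (h.bigPos_ne_smallPos (by omega) (by omega))
  | upper p =>
    obtain ⟨hp, h1, h2⟩ := stepOK_upper_iff.1 ⟨hc, heq⟩
    cases c' with
    | plain q =>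
      obtain ⟨hq, -, -, h3⟩ := h.stepOK_plain_iff.1 ⟨hc', rfl, rfl⟩
      exact absurd (h3.trans h2.symm) (h.bigPos_ne_smallPos hq (by omega))
    | lower q =>
      obtain ⟨hq, h3, -⟩ := h.stepOK_lower_iff.1 ⟨hc', rfl⟩
      exact absurd (h3.trans h1.symm) (h.bigPos_ne_smallPos (by omega) (by omega))
    | upper q =>
      obtain ⟨hq, h3, -⟩ := stepOK_upper_iff.1 ⟨hc', rfl⟩
      rw [h.smallPos_inj (by omega) (by omega) (h1.trans h3.symm)]

/-- For two plain letters that may both follow `s`, the larger one has the strictly smaller count,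
so `f` separates them. -/
theorem eq_of_fStep_eq {s : List Letter} {c c' : Letter} (hc : StepOK a b s c)
    (hc' : StepOK a b s c') (heq : fStep b s c = fStep b s c') : c = c' := by
  cases c <;> cases c' <;> simp only [fStep, reduceCtorEq, plain.injEq] at heq
  case plain.plain p q =>
    obtain ⟨hp, hpb, hlt⟩ := hc
    obtain ⟨hq, hqb, hlt'⟩ := hc'
    rcases lt_trichotomy p q with h1 | rfl | h1
    · have := hlt' p hp.1 h1
      omega
    · rfl
    · have := hlt q hq.1 h1
      omega
  all_goals exact heq

theorem injective_of_concat {B : Type*} {g : List Letter → List B}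
    {st : List Letter → Letter → B} (h0 : g [] = [])
    (hg : ∀ s c, g (s ++ [c]) = g s ++ [st s c])
    (hst : ∀ s c c', Valid a b s → StepOK a b s c → StepOK a b s c' → st s c = st s c' → c = c')
    {w w' : List Letter} (hw : Valid a b w) (hw' : Valid a b w') (heq : g w = g w') : w = w' := by
  induction w using List.reverseRecOn generalizing w' with
  | nil =>
    rcases List.eq_nil_or_concat w' with rfl | ⟨s, c, rfl⟩
    · rfl
    · rw [List.concat_eq_append, hg, h0] at heq
      simp at heq
  | append_singleton s c ih =>
    rcases List.eq_nil_or_concat w' with rfl | ⟨s', c', rfl⟩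
    · rw [hg, h0] at heq
      simp at heq
    · rw [List.concat_eq_append] at *
      rw [hg, hg] at heq
      obtain ⟨h1, h2⟩ := List.append_inj' heq rfl
      obtain ⟨hs, hc⟩ := valid_concat.1 hw
      obtain ⟨hs', hc'⟩ := valid_concat.1 hw'
      obtain rfl := ih hs hs' h1
      rw [hst s c c' hs hc hc' (by simpa using h2)]

theorem Valid.psi_injective {w w' : List Letter} (hw : Valid a b w) (hw' : Valid a b w')
    (heq : psi b w = psi b w') : w = w' :=
  injective_of_concat (psi_nil b) (psi_concat b)
    (fun _ _ _ hs hc hc' h => hs.conjugateCounts.eq_of_step_eq hc hc' h) hw hw' heq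

theorem Valid.f_injective {w w' : List Letter} (hw : Valid a b w) (hw' : Valid a b w')
    (heq : f b w = f b w') : w = w' :=
  injective_of_concat (f_nil b) (f_concat b)
    (fun _ _ _ _ hc hc' h => eq_of_fStep_eq hc hc' h) hw hw' heq

/-! The permutations of `psi b w` and of the parts of `w` -/

/-- The plain letters of a word. -/
def plains (w : List Letter) : List ℕ := w.filterMap fun
  | plain j => some j
  | _ => none

/-- The underlined letters of a word. -/
def lowers (w : List Letter) : List ℕ := w.filterMap fun
  | lower j => some j
  | _ => none

/-- The overlined letters of a word. -/
def uppers (w : List Letter) : List ℕ := w.filterMap fun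
  | upper j => some j
  | _ => none

theorem ConjugateCounts.step_range {s : List Letter} (h : ConjugateCounts a b s) {c : Letter}
    (hc : StepOK a b s c) : 1 ≤ step b s c ∧ step b s c < a + b := by
  cases c with
  | plain p =>
    obtain ⟨h1, h2, h3, h4⟩ := h.stepOK_plain_iff.1 ⟨hc, rfl, rfl⟩
    rw [← h3]
    rw [← h3] at h4
    simp only [bigPos, smallPos] at *
    omega
  | lower p =>
    have := h.le p
    obtain ⟨h1, h2⟩ := hc
    simp only [step]
    omega
  | upper p =>
    have := h.f_le p
    obtain ⟨h1, h2⟩ := hc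
    simp only [step]
    omega

theorem Valid.psi_range {w : List Letter} (hw : Valid a b w) :
    ∀ i ∈ psi b w, 1 ≤ i ∧ i < a + b := by
  induction w using List.reverseRecOn with
  | nil => simp
  | append_singleton s c ih =>
    obtain ⟨hs, hc⟩ := valid_concat.1 hw
    rw [psi_concat]
    simp only [List.mem_append, List.mem_singleton]
    rintro i (hi | rfl)
    · exact ih hs i hi
    · exact hs.conjugateCounts.step_range hc

theorem Valid.lowers_range {w : List Letter} (hw : Valid a b w) :
    ∀ i ∈ lowers w, 1 ≤ i ∧ i < a := by
  intro i hi
  obtain ⟨c, hc, hci⟩ := List.mem_filterMap.1 hi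
  obtain ⟨s, t, rfl⟩ := List.append_of_mem hc
  have := hw s c t rfl
  cases c <;> simp at hci
  subst hci
  exact this.1

theorem Valid.uppers_range {w : List Letter} (hw : Valid a b w) :
    ∀ i ∈ uppers w, 1 ≤ i ∧ i < b := by
  intro i hi
  obtain ⟨c, hc, hci⟩ := List.mem_filterMap.1 hi
  obtain ⟨s, t, rfl⟩ := List.append_of_mem hc
  have := hw s c t rfl
  cases c <;> simp at hci
  subst hci
  exact this.1

/-- The invariant linking `psi` to the parts of `w`: plain letters never change the order of the
large values among themselves, nor that of the small ones, and the other letters act on one of these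
orders only. -/
theorem Valid.wordPerm_psi {w : List Letter} (hw : Valid a b w) :
    (∀ j, 1 ≤ j ∧ j ≤ a →
      wordPerm (psi b w) (bigPos b w j) = b + wordPerm (lowers w) j) ∧
    ∀ k, 1 ≤ k ∧ k ≤ b →
      wordPerm (psi b w) (smallPos b w k) = wordPerm (uppers w) k := by
  induction w using List.reverseRecOn with
  | nil =>
    refine ⟨fun j hj => ?_, fun k hk => ?_⟩
    · simp [lowers, bigPos, Nat.add_comm]
    · simp [uppers, smallPos]
  | append_singleton s c ih =>
    obtain ⟨hs, hc⟩ := valid_concat.1 hw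
    obtain ⟨ih1, ih2⟩ := ih hs
    have h := hs.conjugateCounts
    rw [psi_concat, wordPerm_append, wordPerm_singleton]
    simp only [Perm.mul_apply]
    cases c with
    | plain p =>
      have hl : lowers (s ++ [plain p]) = lowers s := by simp [lowers]
      have hu : uppers (s ++ [plain p]) = uppers s := by simp [uppers]
      obtain ⟨hp, hk, h1, h2⟩ := h.stepOK_plain_iff.1 ⟨hc, rfl, rfl⟩
      rw [hl, hu]
      refine ⟨fun j hj => ?_, fun k hk' => ?_⟩
      · rw [← ih1 j hj]
        congr 1
        by_cases hjp : p = j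
        · subst hjp
          have : bigPos b (s ++ [plain p]) p = step b s (plain p) := by
            simp only [bigPos, step, N_append, N_plain, if_true]
            omega
          rw [this, swap_apply_left, h2]
        · have : bigPos b (s ++ [plain p]) j = bigPos b s j := by simp [bigPos, hjp]
          rw [this]
          refine swap_apply_of_ne_of_ne ?_ ?_
          · rw [← h1]
            exact h.bigPos_ne_smallPos hj hk
          · rw [← h2]
            exact fun he => hjp (h.bigPos_inj hp.1 hj.1 he.symm)
      · rw [← ih2 k hk']
        congr 1
        by_cases hkp : b - N p s = k
        · subst hkp
          have : smallPos b (s ++ [plain p]) (b - N p s) = smallPos b s (b - N p s) + 1 := by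
            simp [smallPos, f_concat, Nat.add_assoc]
          rw [this, h1, swap_apply_right]
        · have : smallPos b (s ++ [plain p]) k = smallPos b s k := by
            simp [smallPos, f_concat, hkp]
          rw [this]
          refine swap_apply_of_ne_of_ne ?_ ?_
          · rw [← h1]
            exact fun he => hkp (h.smallPos_inj hk hk' he.symm)
          · rw [← h2]
            exact (h.bigPos_ne_smallPos hp hk').symm
    | lower p =>
      have hl : lowers (s ++ [lower p]) = lowers s ++ [p] := by simp [lowers]
      have hu : uppers (s ++ [lower p]) = uppers s := by simp [uppers]
      have hb : ∀ j, bigPos b (s ++ [lower p]) j = bigPos b s j := by simp [bigPos]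
      have hsm : ∀ k, smallPos b (s ++ [lower p]) k = smallPos b s k := by
        simp [smallPos, f_concat]
      obtain ⟨hp, h1, h2⟩ := h.stepOK_lower_iff.1 ⟨hc, rfl⟩
      rw [hl, hu, wordPerm_append, wordPerm_singleton]
      simp only [Perm.mul_apply, hb, hsm]
      refine ⟨fun j hj => ?_, fun k hk => ?_⟩
      -- On the positions of the large values, exchanging neighbouring positions is exchanging the
      -- numbers `p` and `p + 1`.
      · rw [← ih1 _ ((fixesOutside_swap (n := a) hp).mapsTo hj), ← h2, ← h1]
        congr 1
        by_cases hj1 : j = p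
        · subst hj1; simp
        by_cases hj2 : j = p + 1
        · subst hj2; simp
        rw [swap_apply_of_ne_of_ne hj1 hj2, swap_apply_of_ne_of_ne]
        · exact fun he => hj1 (h.bigPos_inj hj.1 hp.1 he)
        · exact fun he => hj2 (h.bigPos_inj hj.1 (by omega) he)
      · rw [← ih2 k hk, ← h2, ← h1, swap_apply_of_ne_of_ne]
        · exact (h.bigPos_ne_smallPos (by omega) hk).symm
        · exact (h.bigPos_ne_smallPos (by omega) hk).symm
    | upper p =>
      have hl : lowers (s ++ [upper p]) = lowers s := by simp [lowers]
      have hu : uppers (s ++ [upper p]) = uppers s ++ [p] := by simp [uppers]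
      have hb : ∀ j, bigPos b (s ++ [upper p]) j = bigPos b s j := by simp [bigPos]
      have hsm : ∀ k, smallPos b (s ++ [upper p]) k = smallPos b s k := by
        simp [smallPos, f_concat]
      obtain ⟨hp, h1, h2⟩ := stepOK_upper_iff.1 ⟨hc, rfl⟩
      rw [hl, hu, wordPerm_append, wordPerm_singleton]
      simp only [Perm.mul_apply, hb, hsm]
      refine ⟨fun j hj => ?_, fun k hk => ?_⟩
      · rw [← ih1 j hj, ← h2, ← h1, swap_apply_of_ne_of_ne]
        · exact h.bigPos_ne_smallPos hj (by omega)
        · exact h.bigPos_ne_smallPos hj (by omega)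
      · rw [← ih2 _ ((fixesOutside_swap (n := b) hp).mapsTo hk), ← h2, ← h1]
        congr 1
        by_cases hk1 : k = p
        · subst hk1; simp
        by_cases hk2 : k = p + 1
        · subst hk2; simp
        rw [swap_apply_of_ne_of_ne hk1 hk2, swap_apply_of_ne_of_ne]
        · exact fun he => hk1 (h.smallPos_inj hk (by omega) he)
        · exact fun he => hk2 (h.smallPos_inj hk (by omega) he)

theorem Valid.wordPerm_lowers_range {w : List Letter} (hw : Valid a b w) {j : ℕ}
    (hj : 1 ≤ j ∧ j ≤ a) : 1 ≤ wordPerm (lowers w) j ∧ wordPerm (lowers w) j ≤ a :=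
  (fixesOutside_wordPerm hw.lowers_range).mapsTo hj

theorem Valid.wordPerm_uppers_range {w : List Letter} (hw : Valid a b w) {k : ℕ}
    (hk : 1 ≤ k ∧ k ≤ b) : 1 ≤ wordPerm (uppers w) k ∧ wordPerm (uppers w) k ≤ b :=
  (fixesOutside_wordPerm hw.uppers_range).mapsTo hk

/-- A plain letter is always an ascent, since it exchanges a small value with a large one on its
right. For the other letters the comparison is the one in the underlined or overlined word. -/
theorem Valid.ascending_psi_iff {w : List Letter} (hw : Valid a b w) :
    Ascending (psi b w) ↔ Ascending (lowers w) ∧ Ascending (uppers w) := by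
  induction w using List.reverseRecOn with
  | nil => exact iff_of_true ascending_nil ⟨ascending_nil, ascending_nil⟩
  | append_singleton s c ih =>
    obtain ⟨hs, hc⟩ := valid_concat.1 hw
    obtain ⟨hb, hsm⟩ := hs.wordPerm_psi
    have h := hs.conjugateCounts
    rw [psi_concat, ascending_concat, ih hs]
    cases c with
    | plain p =>
      have hl : lowers (s ++ [plain p]) = lowers s := by simp [lowers]
      have hu : uppers (s ++ [plain p]) = uppers s := by simp [uppers]
      obtain ⟨hp, hk, h1, h2⟩ := h.stepOK_plain_iff.1 ⟨hc, rfl, rfl⟩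
      rw [hl, hu, and_iff_left_iff_imp, ← h2, ← h1, hb p hp, hsm _ hk]
      have h3 := hs.wordPerm_lowers_range hp
      have h4 := hs.wordPerm_uppers_range hk
      omega
    | lower p =>
      have hl : lowers (s ++ [lower p]) = lowers s ++ [p] := by simp [lowers]
      have hu : uppers (s ++ [lower p]) = uppers s := by simp [uppers]
      obtain ⟨hp, h1, h2⟩ := h.stepOK_lower_iff.1 ⟨hc, rfl⟩
      rw [hl, hu, ascending_concat, ← h2, ← h1, hb p (by omega), hb (p + 1) (by omega)]
      simp only [add_lt_add_iff_left]
      tauto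
    | upper p =>
      have hl : lowers (s ++ [upper p]) = lowers s := by simp [lowers]
      have hu : uppers (s ++ [upper p]) = uppers s ++ [p] := by simp [uppers]
      obtain ⟨hp, h1, h2⟩ := stepOK_upper_iff.1 ⟨hc, rfl⟩
      rw [hl, hu, ascending_concat, ← h2, ← h1, hsm p (by omega), hsm (p + 1) (by omega)]
      tauto

/-! ### Every ascending word comes from a valid word -/

theorem ConjugateCounts.eq_succ_of_bigPos {s : List Letter} (h : ConjugateCounts a b s) {j k : ℕ}
    (hj : 1 ≤ j) (hk : 1 ≤ k) (heq : bigPos b s k = bigPos b s j + 1) : k = j + 1 := by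
  rcases lt_trichotomy k (j + 1) with h1 | h1 | h1
  · rcases (show k ≤ j by omega).lt_or_eq with h2 | rfl
    · have := h.bigPos_lt hk h2; omega
    · omega
  · exact h1
  · have := h.bigPos_lt (j := j + 1) (by omega) h1
    have := h.bigPos_lt (k := j + 1) hj (by omega)
    omega

theorem ConjugateCounts.eq_succ_of_smallPos {s : List Letter} (h : ConjugateCounts a b s)
    {j k : ℕ} (hj : 1 ≤ j ∧ j ≤ b) (hk : 1 ≤ k ∧ k ≤ b)
    (heq : smallPos b s k = smallPos b s j + 1) : k = j + 1 := by
  rcases lt_trichotomy k (j + 1) with h1 | h1 | h1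
  · rcases (show k ≤ j by omega).lt_or_eq with h2 | rfl
    · have := h.smallPos_lt hk.1 h2 hj.2; omega
    · omega
  · exact h1
  · have := h.smallPos_lt (j := j + 1) (by omega) h1 hk.2
    have := h.smallPos_lt (k := j + 1) hj.1 (by omega) (by omega)
    omega

theorem exists_valid_of_ascending {r : List ℕ} (hr : ∀ i ∈ r, 1 ≤ i ∧ i < a + b)
    (hasc : Ascending r) : ∃ w, Valid a b w ∧ psi b w = r := by
  induction r using List.reverseRecOn with
  | nil => exact ⟨[], valid_nil a b, rfl⟩
  | append_singleton r i ih =>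
    rw [ascending_concat] at hasc
    obtain ⟨s, hs, rfl⟩ := ih (fun j hj => hr j (by simp [hj])) hasc.1
    have hi := hr i (by simp)
    have h := hs.conjugateCounts
    obtain ⟨hb, hsm⟩ := hs.wordPerm_psi
    suffices hc : ∃ c, StepOK a b s c ∧ step b s c = i by
      obtain ⟨c, hc, rfl⟩ := hc
      exact ⟨s ++ [c], valid_concat.2 ⟨hs, hc⟩, psi_concat b s c⟩
    have hlt := hasc.2
    rcases h.cover i (by omega) (by omega) with ⟨j, hj, hji⟩ | ⟨k, hk, hki⟩ <;>
      rcases h.cover (i + 1) (by omega) (by omega) with ⟨j', hj', hji'⟩ | ⟨k', hk', hki'⟩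
    · have : j' = j + 1 := h.eq_succ_of_bigPos hj.1 hj'.1 (by omega)
      subst this
      exact ⟨lower j, h.stepOK_lower_iff.2 ⟨by omega, hji, hji'⟩⟩
    -- A large value directly to the left of a small one would be a descent; the other three
    -- combinations are the three kinds of letters.
    · rw [← hki', ← hji, hb j hj, hsm k' hk'] at hlt
      have h3 := hs.wordPerm_lowers_range hj
      have h4 := hs.wordPerm_uppers_range hk'
      omega
    · have := h.stepOK_plain_iff.2 ⟨hj', hk, hki, hji'⟩
      exact ⟨plain j', this.1, this.2.1⟩
    · have : k' = k + 1 := h.eq_succ_of_smallPos hk hk' (by omega)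
      subst this
      exact ⟨upper k, stepOK_upper_iff.2 ⟨by omega, hki, hki'⟩⟩

/-! The vertex set in terms of valid words -/

theorem isShuffle_iff {x u v : List ℕ} {w : List Letter} :
    IsShuffle (x.map plain) (u.map lower) (v.map upper) w ↔
      plains w = x ∧ lowers w = u ∧ uppers w = v := by
  constructor
  · intro h
    generalize hX : x.map plain = X at h
    generalize hU : u.map lower = U at h
    generalize hV : v.map upper = V at h
    induction h generalizing x u v with
    | nil => simp_all [plains, lowers, uppers]
    | fst c _ ih =>
      obtain ⟨y, x', rfl, rfl, hx⟩ := List.map_eq_cons_iff.1 hX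
      obtain ⟨h1, h2, h3⟩ := ih hx hU hV
      exact ⟨congrArg (y :: ·) h1, h2, h3⟩
    | snd c _ ih =>
      obtain ⟨y, x', rfl, rfl, hx⟩ := List.map_eq_cons_iff.1 hU
      obtain ⟨h1, h2, h3⟩ := ih hX hx hV
      exact ⟨h1, congrArg (y :: ·) h2, h3⟩
    | trd c _ ih =>
      obtain ⟨y, x', rfl, rfl, hx⟩ := List.map_eq_cons_iff.1 hV
      obtain ⟨h1, h2, h3⟩ := ih hX hU hx
      exact ⟨h1, h2, congrArg (y :: ·) h3⟩
  · rintro ⟨rfl, rfl, rfl⟩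
    induction w with
    | nil => exact IsShuffle.nil
    | cons c w ih =>
      cases c with
      | plain j => exact IsShuffle.fst (plain j) ih
      | lower j => exact IsShuffle.snd (lower j) ih
      | upper j => exact IsShuffle.trd (upper j) ih

theorem count_plains (j : ℕ) (w : List Letter) : (plains w).count j = N j w := by
  induction w with
  | nil => rfl
  | cons c w ih =>
    rw [← List.singleton_append, N_append, ← ih]
    cases c <;> simp [plains, List.count_cons, Nat.add_comm]

theorem mem_plains {j : ℕ} {w : List Letter} : j ∈ plains w ↔ plain j ∈ w := by
  rw [← List.count_pos_iff, count_plains, N, List.count_pos_iff]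

theorem coe_eq_sum_replicate_iff {x : List ℕ} :
    (x : Multiset ℕ) = ∑ i ∈ Finset.Icc 1 a, Multiset.replicate b i ↔
      ∀ j, x.count j = if 1 ≤ j ∧ j ≤ a then b else 0 := by
  rw [Multiset.ext]
  refine forall_congr' fun j => ?_
  rw [Multiset.coe_count, Multiset.count_sum']
  simp [Multiset.count_replicate]

theorem getElem?_eq_some_iff_split {A : Type*} {w : List A} {i : ℕ} {c : A} :
    w[i]? = some c ↔ ∃ t, w = w.take i ++ c :: t := by
  constructor
  · intro h
    obtain ⟨hi, rfl⟩ := List.getElem?_eq_some_iff.1 h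
    exact ⟨w.drop (i + 1), by simp⟩
  · rintro ⟨t, ht⟩
    have hi : i < w.length := by
      by_contra hlt
      have := congrArg List.length ht
      rw [List.take_of_length_le (by omega)] at this
      simp at this
    have h1 : (w.take i).length = i := by simp; omega
    rw [ht, List.getElem?_append_right (by omega), h1]
    simp

theorem f_take (b : ℕ) (w : List Letter) (i : ℕ) : (f b w).take i = f b (w.take i) := by
  by_cases hi : i ≤ w.length
  · conv_lhs => rw [← List.take_append_drop i w, f_append]
    rw [List.take_append_of_le_length (by simp [hi]), List.take_of_length_le (by simp)]
  · rw [List.take_of_length_le (by simp; omega), List.take_of_length_le (by omega)]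

theorem Valid.N_eq_zero {w : List Letter} (hw : Valid a b w) {j : ℕ} (hj : ¬ (1 ≤ j ∧ j ≤ a)) :
    N j w = 0 := by
  rw [N, List.count_eq_zero]
  intro hmem
  obtain ⟨s, t, rfl⟩ := List.append_of_mem hmem
  exact hj (hw s _ t rfl).1

/-- Validity already makes the plain word a ballot sequence, so only its content remains to be
prescribed. -/
theorem mem_ballot_iff {w : List Letter} (hw : Valid a b w) :
    plains w ∈ ballot a b ↔ ∀ j, 1 ≤ j → j ≤ a → N j w = b := by
  rw [ballot, Set.mem_ofPred_eq, coe_eq_sum_replicate_iff]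
  simp only [count_plains]
  constructor
  · rintro ⟨-, h⟩ j hj hja
    rw [h, if_pos ⟨hj, hja⟩]
  · intro h
    refine ⟨⟨fun j hj => ?_, fun j k hj hjk m _ => ?_⟩, fun j => ?_⟩
    · obtain ⟨s, t, rfl⟩ := List.append_of_mem (mem_plains.1 hj)
      exact (hw s _ t rfl).1.1
    -- A prefix of the plain word is the plain word of a prefix, whose counts form a partition.
    · obtain ⟨l, ⟨t, rfl⟩, hl⟩ := List.prefix_filterMap_iff.1 (List.take_prefix m (plains w))
      rw [hl]
      change (plains l).count k ≤ (plains l).count j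
      rw [count_plains, count_plains]
      exact hw.left.conjugateCounts.anti j k hj hjk.le
    · split_ifs with hj
      · exact h j hj.1 hj.2
      · exact hw.N_eq_zero hj

theorem mem_vertexSet_iff {α : Perm (Fin a)} {β : Perm (Fin b)} {w : List Letter} :
    w ∈ vertexSet α β ↔ Valid a b w ∧ (∀ j, 1 ≤ j → j ≤ a → N j w = b) ∧
      lowers w ∈ reducedWords α ∧ uppers w ∈ reducedWords β := by
  simp only [vertexSet, Set.mem_iUnion, exists_prop, restrictedShuffle, Set.mem_ofPred_eq,
    isShuffle_iff, f_take]
  constructor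
  · rintro ⟨x, hx, u, hu, v, hv, ⟨rfl, rfl, rfl⟩, h1, h2⟩
    have hw : Valid a b w := by
      rintro s c t rfl
      have htake : (s ++ c :: t).take s.length = s := by simp
      have hget : (s ++ c :: t)[s.length]? = some c := by simp
      cases c with
      | plain j =>
        obtain ⟨⟨-, hball⟩, hx⟩ := hx
        rw [coe_eq_sum_replicate_iff] at hx
        have hj := hx j
        have hpre : plains (s ++ plain j :: t) = plains (s ++ [plain j]) ++ plains t := by
          simp [plains]
        rw [count_plains, ← List.singleton_append, N_append, N_append, N_plain, if_pos rfl] at hj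
        have hja : 1 ≤ j ∧ j ≤ a := by
          by_contra hno
          rw [if_neg hno] at hj
          omega
        rw [if_pos hja] at hj
        refine ⟨hja, by omega, fun k hk hkj => ?_⟩
        -- The ballot condition is used for the prefix that includes the new `j`; this makes the
        -- inequality for `s` strict.
        have := hball k j hk hkj (plains (s ++ [plain j])).length (by simp [hpre])
        rw [hpre, List.take_left, count_plains, count_plains] at this
        simp only [N_append, N_plain, if_true, if_neg hkj.ne'] at this
        omega
      | lower j =>
        have hj := (mem_reducedWords_iff.1 hu).1 j (by simp [lowers])
        have := h1 _ _ hget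
        rw [htake] at this
        exact ⟨hj, this⟩
      | upper j =>
        have hj := (mem_reducedWords_iff.1 hv).1 j (by simp [uppers])
        have := h2 _ _ hget
        rw [htake] at this
        exact ⟨hj, this⟩
    exact ⟨hw, (mem_ballot_iff hw).1 hx, hu, hv⟩
  · rintro ⟨hw, hN, hu, hv⟩
    refine ⟨_, (mem_ballot_iff hw).2 hN, _, hu, _, hv, ⟨rfl, rfl, rfl⟩, fun i j hij => ?_,
      fun i j hij => ?_⟩
    · obtain ⟨t, ht⟩ := getElem?_eq_some_iff_split.1 hij
      exact (hw _ _ _ ht).2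
    · obtain ⟨t, ht⟩ := getElem?_eq_some_iff_split.1 hij
      exact (hw _ _ _ ht).2

/-! The bijection -/

theorem natPerm_inflation21_left (α : Perm (Fin a)) (β : Perm (Fin b)) {j : ℕ}
    (hj : 1 ≤ j ∧ j ≤ a) : natPerm (a + b) (inflation21 α β) j = b + natPerm a α j := by
  obtain ⟨i, rfl⟩ : ∃ i : Fin a, (i : ℕ) + 1 = j := ⟨⟨j - 1, by omega⟩, by simp; omega⟩
  have h := natPerm_apply (inflation21 α β) (Fin.castAdd b i)
  rw [inflation21_left, Fin.val_castAdd] at h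
  rw [h, natPerm_apply]
  omega

theorem natPerm_inflation21_right (α : Perm (Fin a)) (β : Perm (Fin b)) {k : ℕ}
    (hk : 1 ≤ k ∧ k ≤ b) : natPerm (a + b) (inflation21 α β) (k + a) = natPerm b β k := by
  obtain ⟨i, rfl⟩ : ∃ i : Fin b, (i : ℕ) + 1 = k := ⟨⟨k - 1, by omega⟩, by simp; omega⟩
  have h := natPerm_apply (inflation21 α β) (Fin.natAdd a i)
  rw [inflation21_right, Fin.val_natAdd] at h
  rw [natPerm_apply, ← h]
  congr 1
  omega

theorem FixesOutside.ext {n : ℕ} {σ τ : Perm ℕ} (hσ : FixesOutside n σ) (hτ : FixesOutside n τ)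
    (h : ∀ x, 1 ≤ x ∧ x ≤ n → σ x = τ x) : σ = τ := by
  refine Equiv.ext fun x => ?_
  by_cases hx : 1 ≤ x ∧ x ≤ n
  · exact h x hx
  · rw [hσ x (by omega), hτ x (by omega)]

theorem ConjugateCounts.pos_of_full {w : List Letter} (h : ConjugateCounts a b w)
    (hN : ∀ j, 1 ≤ j → j ≤ a → N j w = b) :
    (∀ j, 1 ≤ j ∧ j ≤ a → bigPos b w j = j) ∧ ∀ k, 1 ≤ k ∧ k ≤ b → smallPos b w k = k + a := by
  refine ⟨fun j hj => ?_, fun k hk => ?_⟩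
  · rw [bigPos, hN j hj.1 hj.2]
    omega
  · rw [smallPos]
    have h1 := h.f_le k
    rcases Nat.eq_zero_or_pos a with rfl | ha
    · omega
    · have h2 := h.galois a k ha le_rfl hk.1 hk.2
      have := hN a ha le_rfl
      omega

theorem Valid.wordPerm_psi_eq_iff {w : List Letter} (hw : Valid a b w) (α : Perm (Fin a))
    (β : Perm (Fin b)) : wordPerm (psi b w) = natPerm (a + b) (inflation21 α β) ↔
      (∀ j, 1 ≤ j → j ≤ a → N j w = b) ∧ wordPerm (lowers w) = natPerm a α ∧
        wordPerm (uppers w) = natPerm b β := by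
  have h := hw.conjugateCounts
  obtain ⟨hb, hsm⟩ := hw.wordPerm_psi
  constructor
  · intro heq
    rw [heq] at hb hsm
    -- If some count were below `b`, so would be that of `a`. The last large value would then stand
    -- beyond position `a`, where the inflation has only small values.
    have hN : ∀ j, 1 ≤ j → j ≤ a → N j w = b := by
      intro j hj hja
      have h1 := h.le j
      have h2 := h.anti j a hj hja
      have h4 := hw.wordPerm_lowers_range (j := a) (by omega)
      have h5 := hb a (by omega)
      by_contra hne
      have h6 : bigPos b w a = (b - N a w) + a := by
        rw [bigPos]
        have := h.le a
        omega
      rw [h6, natPerm_inflation21_right α β (by omega)] at h5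
      have := (fixesOutside_natPerm β).mapsTo (x := b - N a w) (by omega)
      omega
    obtain ⟨hb', hsm'⟩ := h.pos_of_full hN
    refine ⟨hN, ?_, ?_⟩
    · refine (fixesOutside_wordPerm hw.lowers_range).ext (fixesOutside_natPerm α) fun j hj => ?_
      have := hb j hj
      rw [hb' j hj, natPerm_inflation21_left α β hj] at this
      omega
    · refine (fixesOutside_wordPerm hw.uppers_range).ext (fixesOutside_natPerm β) fun k hk => ?_
      have := hsm k hk
      rw [hsm' k hk, natPerm_inflation21_right α β hk] at this
      exact this.symm
  · rintro ⟨hN, hα, hβ⟩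
    obtain ⟨hb', hsm'⟩ := h.pos_of_full hN
    refine (fixesOutside_wordPerm hw.psi_range).ext (fixesOutside_natPerm _) fun x hx => ?_
    rcases h.cover x hx.1 hx.2 with ⟨j, hj, rfl⟩ | ⟨k, hk, rfl⟩
    · rw [hb j hj, hb' j hj, natPerm_inflation21_left α β hj, hα]
    · rw [hsm k hk, hsm' k hk, natPerm_inflation21_right α β hk, hβ]

theorem mem_vertexSet_iff_psi_mem {α : Perm (Fin a)} {β : Perm (Fin b)} {w : List Letter} :
    w ∈ vertexSet α β ↔ Valid a b w ∧ psi b w ∈ reducedWords (inflation21 α β) := by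
  rw [mem_vertexSet_iff]
  refine and_congr_right fun hw => ?_
  rw [mem_reducedWords_iff, mem_reducedWords_iff, mem_reducedWords_iff,
    hw.wordPerm_psi_eq_iff, hw.ascending_psi_iff]
  have h1 := hw.psi_range
  have h2 := hw.lowers_range
  have h3 := hw.uppers_range
  tauto

theorem psi_bijOn (α : Perm (Fin a)) (β : Perm (Fin b)) :
    Set.BijOn (psi b) (vertexSet α β) (reducedWords (inflation21 α β)) := by
  refine ⟨fun w hw => (mem_vertexSet_iff_psi_mem.1 hw).2, fun w hw w' hw' heq => ?_,
    fun r hr => ?_⟩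
  · exact (mem_vertexSet_iff.1 hw).1.psi_injective (mem_vertexSet_iff.1 hw').1 heq
  · obtain ⟨hrange, -, hasc⟩ := mem_reducedWords_iff.1 hr
    obtain ⟨w, hw, rfl⟩ := exists_valid_of_ascending hrange hasc
    exact ⟨w, mem_vertexSet_iff_psi_mem.2 ⟨hw, hr⟩, rfl⟩

/-! Replacing a factor of a valid word -/

/-- After `s`, each of the words `q` and `q'` may follow, and they contain the same plain letters. -/
structure Interchangeable (a b : ℕ) (s q q' : List Letter) : Prop where
  left : Valid a b (s ++ q)
  right : Valid a b (s ++ q')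
  N_eq : ∀ j, N j q = N j q'

theorem Interchangeable.sameCounts {s q q' : List Letter} (h : Interchangeable a b s q q') :
    SameCounts b (s ++ q) (s ++ q') :=
  h.left.conjugateCounts.sameCounts_of_N_eq h.right.conjugateCounts fun j => by simp [h.N_eq j]

theorem exists_split_of_f_eq {w S T : List Letter} (h : f b w = S ++ T) :
    ∃ s t, w = s ++ t ∧ f b s = S ∧ fTail b s t = T := by
  refine ⟨w.take S.length, w.drop S.length, by simp, ?_⟩
  refine List.append_inj (by rw [← f_append, List.take_append_drop, h]) ?_
  have := congrArg List.length h
  simp at this ⊢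
  omega

theorem exists_split_of_psi_eq {w : List Letter} {S T : List ℕ} (h : psi b w = S ++ T) :
    ∃ s t, w = s ++ t ∧ psi b s = S ∧ psiTail b s t = T := by
  refine ⟨w.take S.length, w.drop S.length, by simp, ?_⟩
  refine List.append_inj (by rw [← psi_append, List.take_append_drop, h]) ?_
  have := congrArg List.length h
  simp at this ⊢
  omega

/-- This brings a move made in `f b w` back to `w`: injectivity identifies the prefix `s ++ q`,
equal counts allow the same tail after `s ++ q'`, and injectivity identifies the resulting word with
`w'`. -/
theorem Interchangeable.exists_of_f_eq {s q q' w w' T : List Letter}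
    (h : Interchangeable a b s q q') (hw : Valid a b w) (hw' : Valid a b w')
    (hf : f b w = f b (s ++ q) ++ T) (hf' : f b w' = f b (s ++ q') ++ T) :
    ∃ t, w = s ++ q ++ t ∧ w' = s ++ q' ++ t := by
  obtain ⟨v, t, rfl, hv, rfl⟩ := exists_split_of_f_eq hf
  obtain rfl := hw.left.f_injective h.left hv
  refine ⟨t, rfl, hw'.f_injective (h.sameCounts.valid_append h.right hw) ?_⟩
  rw [hf', f_append b (s ++ q'), h.sameCounts.fTail_eq]

theorem Interchangeable.exists_of_psi_eq {s q q' w w' : List Letter} {T : List ℕ}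
    (h : Interchangeable a b s q q') (hw : Valid a b w) (hw' : Valid a b w')
    (hf : psi b w = psi b (s ++ q) ++ T) (hf' : psi b w' = psi b (s ++ q') ++ T) :
    ∃ t, w = s ++ q ++ t ∧ w' = s ++ q' ++ t := by
  obtain ⟨v, t, rfl, hv, rfl⟩ := exists_split_of_psi_eq hf
  obtain rfl := hw.left.psi_injective h.left hv
  refine ⟨t, rfl, hw'.psi_injective (h.sameCounts.valid_append h.right hw) ?_⟩
  rw [hf', psi_append b (s ++ q'), h.sameCounts.psiTail_eq]

theorem Interchangeable.exists_psi_eq {s q q' : List Letter} (h : Interchangeable a b s q q')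
    (t : List Letter) : ∃ T, psi b (s ++ q ++ t) = psi b s ++ psiTail b s q ++ T ∧
      psi b (s ++ q' ++ t) = psi b s ++ psiTail b s q' ++ T :=
  ⟨psiTail b (s ++ q) t, by rw [psi_append, psi_append], by
    rw [h.sameCounts.psiTail_eq, psi_append, psi_append]⟩

theorem Interchangeable.exists_f_eq {s q q' : List Letter} (h : Interchangeable a b s q q')
    (t : List Letter) : ∃ T, f b (s ++ q ++ t) = f b s ++ fTail b s q ++ T ∧
      f b (s ++ q' ++ t) = f b s ++ fTail b s q' ++ T :=
  ⟨fTail b (s ++ q) t, by rw [f_append, f_append], by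
    rw [h.sameCounts.fTail_eq, f_append, f_append]⟩

theorem Valid.stepOK {s t : List Letter} {c : Letter} (h : Valid a b (s ++ c :: t)) :
    StepOK a b s c := h s c t rfl

theorem valid_append_cons {s t : List Letter} {c : Letter} :
    Valid a b (s ++ c :: t) ↔ Valid a b (s ++ [c] ++ t) := by
  rw [← List.append_cons]

@[simp] theorem bigPos_concat_plain (b : ℕ) (s : List Letter) (p j : ℕ) :
    bigPos b (s ++ [plain p]) j = if p = j then bigPos b s j - 1 else bigPos b s j := by
  by_cases h : p = j
  · simp [bigPos, h, Nat.sub_sub]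
  · simp [bigPos, h]

@[simp] theorem smallPos_concat_plain (b : ℕ) (s : List Letter) (p k : ℕ) :
    smallPos b (s ++ [plain p]) k =
      if b - N p s = k then smallPos b s k + 1 else smallPos b s k := by
  by_cases h : b - N p s = k
  · simp [smallPos, f_concat, h, Nat.add_assoc]
  · simp [smallPos, f_concat, h]

@[simp] theorem bigPos_concat_lower (b : ℕ) (s : List Letter) (p j : ℕ) :
    bigPos b (s ++ [lower p]) j = bigPos b s j := by simp [bigPos]

@[simp] theorem bigPos_concat_upper (b : ℕ) (s : List Letter) (p j : ℕ) :
    bigPos b (s ++ [upper p]) j = bigPos b s j := by simp [bigPos]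

@[simp] theorem smallPos_concat_lower (b : ℕ) (s : List Letter) (p k : ℕ) :
    smallPos b (s ++ [lower p]) k = smallPos b s k := by simp [smallPos, f_concat]

@[simp] theorem smallPos_concat_upper (b : ℕ) (s : List Letter) (p k : ℕ) :
    smallPos b (s ++ [upper p]) k = smallPos b s k := by simp [smallPos, f_concat]

/-! Commutation moves -/

theorem Far.symm {p q : ℕ} (h : Far p q) : Far q p := Or.symm h

/-- The first exchange does not touch the two positions used by the second letter, so the values
there keep their kinds and numbers. -/
theorem ConjugateCounts.stepOK_concat_of_far {s : List Letter} (h : ConjugateCounts a b s)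
    {c c' : Letter} (hc : StepOK a b s c) (hc' : StepOK a b s c')
    (hfar : Far (step b s c) (step b s c')) :
    StepOK a b (s ++ [c]) c' ∧ step b (s ++ [c]) c' = step b s c' := by
  cases c with
  | lower p =>
    have := (sameCounts_concat_lower b s p).symm
    exact ⟨this.stepOK hc', (this.step_eq _).symm⟩
  | upper p =>
    have := (sameCounts_concat_upper b s p).symm
    exact ⟨this.stepOK hc', (this.step_eq _).symm⟩
  | plain p =>
    have hs := h.concat_plain hc
    obtain ⟨hp, hk, h1, h2⟩ := h.stepOK_plain_iff.1 ⟨hc, rfl, rfl⟩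
    cases c' with
    | plain q =>
      obtain ⟨hq, hk', h3, h4⟩ := h.stepOK_plain_iff.1 ⟨hc', rfl, rfl⟩
      have hpq : p ≠ q := by
        rintro rfl
        unfold Far at hfar
        omega
      have hkk : b - N p s ≠ b - N q s := by
        intro he
        rw [he, h3] at h1
        unfold Far at hfar
        omega
      have := hs.stepOK_plain_iff.2 ⟨hq, hk', by rw [smallPos_concat_plain, if_neg hkk, h3],
        by rw [bigPos_concat_plain, if_neg hpq, h4]⟩
      exact ⟨this.1, this.2.1⟩
    | lower q =>
      obtain ⟨hq, h3, h4⟩ := h.stepOK_lower_iff.1 ⟨hc', rfl⟩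
      unfold Far at hfar
      refine hs.stepOK_lower_iff.2 ⟨hq, ?_, ?_⟩
      · rw [bigPos_concat_plain, if_neg, h3]
        rintro rfl
        omega
      · rw [bigPos_concat_plain, if_neg, h4]
        rintro rfl
        omega
    | upper q =>
      obtain ⟨hq, h3, h4⟩ := stepOK_upper_iff.1 ⟨hc', rfl⟩
      unfold Far at hfar
      refine stepOK_upper_iff.2 ⟨hq, ?_, ?_⟩
      · rw [smallPos_concat_plain, if_neg, h3]
        intro he
        rw [he] at h1
        omega
      · rw [smallPos_concat_plain, if_neg, h4]
        intro he
        rw [he] at h1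
        omega

theorem Valid.interchangeable_of_far {s : List Letter} (hs : Valid a b s) {c c' : Letter}
    (hc : StepOK a b s c) (hc' : StepOK a b s c') (hfar : Far (step b s c) (step b s c')) :
    Interchangeable a b s [c, c'] [c', c] ∧ psiTail b s [c, c'] = [step b s c, step b s c'] ∧
      psiTail b s [c', c] = [step b s c', step b s c] := by
  have h1 := hs.conjugateCounts.stepOK_concat_of_far hc hc' hfar
  have h2 := hs.conjugateCounts.stepOK_concat_of_far hc' hc hfar.symm
  refine ⟨⟨?_, ?_, fun j => ?_⟩, ?_, ?_⟩
  · rw [valid_append_cons, valid_concat, valid_concat]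
    exact ⟨⟨hs, hc⟩, h1.1⟩
  · rw [valid_append_cons, valid_concat, valid_concat]
    exact ⟨⟨hs, hc'⟩, h2.1⟩
  · exact List.Perm.count_eq (List.Perm.swap c' c []) _
  · simp [psiTail, h1.2]
  · simp [psiTail, h2.2]

theorem Valid.commMove_psi {s t : List Letter} (hs : Valid a b s) {c c' : Letter}
    (hc : StepOK a b s c) (hc' : StepOK a b s c') (hfar : Far (step b s c) (step b s c')) :
    CommMove (psi b (s ++ [c, c'] ++ t)) (psi b (s ++ [c', c] ++ t)) := by
  obtain ⟨hi, h1, h2⟩ := hs.interchangeable_of_far hc hc' hfar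
  obtain ⟨T, h3, h4⟩ := hi.exists_psi_eq t
  exact ⟨psi b s, T, _, _, hfar, by rw [h3, h1], by rw [h4, h2]⟩

namespace ConjugateCounts

variable {s : List Letter}

theorem far_lower_lower (h : ConjugateCounts a b s) {p q : ℕ} (hp : StepOK a b s (lower p))
    (hq : StepOK a b s (lower q)) : Far (step b s (lower p)) (step b s (lower q)) ↔ Far p q := by
  obtain ⟨hp, h1, h2⟩ := h.stepOK_lower_iff.1 ⟨hp, rfl⟩
  obtain ⟨hq, h3, h4⟩ := h.stepOK_lower_iff.1 ⟨hq, rfl⟩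
  unfold Far
  rcases lt_trichotomy p q with h5 | rfl | h5
  · rcases (show p + 1 ≤ q by omega).lt_or_eq with h6 | rfl
    · have := h.bigPos_lt (by omega) h6
      omega
    · omega
  · omega
  · rcases (show q + 1 ≤ p by omega).lt_or_eq with h6 | rfl
    · have := h.bigPos_lt (by omega) h6
      omega
    · omega

theorem far_upper_upper (h : ConjugateCounts a b s) {p q : ℕ} (hp : StepOK a b s (upper p))
    (hq : StepOK a b s (upper q)) : Far (step b s (upper p)) (step b s (upper q)) ↔ Far p q := by
  obtain ⟨hp, h1, h2⟩ := stepOK_upper_iff.1 ⟨hp, rfl⟩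
  obtain ⟨hq, h3, h4⟩ := stepOK_upper_iff.1 ⟨hq, rfl⟩
  unfold Far
  rcases lt_trichotomy p q with h5 | rfl | h5
  · rcases (show p + 1 ≤ q by omega).lt_or_eq with h6 | rfl
    · have := h.smallPos_lt (by omega) h6 (by omega)
      omega
    · omega
  · omega
  · rcases (show q + 1 ≤ p by omega).lt_or_eq with h6 | rfl
    · have := h.smallPos_lt (by omega) h6 (by omega)
      omega
    · omega

theorem far_lower_upper (h : ConjugateCounts a b s) {p q : ℕ} (hp : StepOK a b s (lower p))
    (hq : StepOK a b s (upper q)) : Far (step b s (lower p)) (step b s (upper q)) := by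
  obtain ⟨hp, h1, h2⟩ := h.stepOK_lower_iff.1 ⟨hp, rfl⟩
  obtain ⟨hq, h3, h4⟩ := stepOK_upper_iff.1 ⟨hq, rfl⟩
  have h5 := h.bigPos_ne_smallPos (j := p) (k := q) (by omega) (by omega)
  have h6 := h.bigPos_ne_smallPos (j := p + 1) (k := q) (by omega) (by omega)
  have h7 := h.bigPos_ne_smallPos (j := p) (k := q + 1) (by omega) (by omega)
  unfold Far
  omega

/-- A plain `q` acts at `bigPos b s q - 1`. For `q < p` this is at least two places left of the
`p`-th large value. For `q > p + 1` the small partner lies beyond the pair `p, p + 1`. For `q = p`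
the letters are neighbours, and `q = p + 1` would put its small partner where the `p`-th large value
stands. `far_upper_plain` is the mirror image, with the number of the small partner in place of `q`.
-/
theorem far_lower_plain (h : ConjugateCounts a b s) {p q : ℕ} (hp : StepOK a b s (lower p))
    (hq : StepOK a b s (plain q)) :
    Far (step b s (lower p)) (step b s (plain q)) ↔ Far p q ∨ q < p := by
  obtain ⟨hp, h1, h2⟩ := h.stepOK_lower_iff.1 ⟨hp, rfl⟩
  obtain ⟨hq, hk, h3, h4⟩ := h.stepOK_plain_iff.1 ⟨hq, rfl, rfl⟩
  have h5 := h.bigPos_ne_smallPos (j := p) (by omega) hk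
  have h6 := h.bigPos_ne_smallPos (j := p + 1) (by omega) hk
  unfold Far
  rcases lt_trichotomy p q with h7 | rfl | h7
  · rcases (show p + 1 ≤ q by omega).lt_or_eq with h8 | rfl
    · have := h.bigPos_lt (by omega) h8
      omega
    · omega
  · omega
  · have := h.bigPos_lt (by omega) h7
    omega

theorem far_upper_plain (h : ConjugateCounts a b s) {p q : ℕ} (hp : StepOK a b s (upper p))
    (hq : StepOK a b s (plain q)) : Far (step b s (upper p)) (step b s (plain q)) ↔
      Far p (b - N q s) ∨ b - N q s < p := by
  obtain ⟨hp, h1, h2⟩ := stepOK_upper_iff.1 ⟨hp, rfl⟩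
  obtain ⟨hq, hk, h3, h4⟩ := h.stepOK_plain_iff.1 ⟨hq, rfl, rfl⟩
  have h5 := h.bigPos_ne_smallPos (k := p) hq (by omega)
  have h6 := h.bigPos_ne_smallPos (k := p + 1) hq (by omega)
  generalize b - N q s = k at *
  unfold Far
  rcases lt_trichotomy p k with h7 | rfl | h7
  · rcases (show p + 1 ≤ k by omega).lt_or_eq with h8 | rfl
    · have := h.smallPos_lt (by omega) h8 hk.2
      omega
    · omega
  · omega
  · have := h.smallPos_lt (by omega) h7 (by omega)
    omega

/-- Neighbouring letters would make one position hold both the large value of one pair and the small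
value of the other. -/
theorem far_plain_plain (h : ConjugateCounts a b s) {p q : ℕ} (hp : StepOK a b s (plain p))
    (hq : StepOK a b s (plain q)) (hne : p ≠ q) :
    Far (step b s (plain p)) (step b s (plain q)) := by
  obtain ⟨hp, hk, h1, h2⟩ := h.stepOK_plain_iff.1 ⟨hp, rfl, rfl⟩
  obtain ⟨hq, hk', h3, h4⟩ := h.stepOK_plain_iff.1 ⟨hq, rfl, rfl⟩
  have h5 := h.bigPos_ne_smallPos hp hk'
  have h6 := h.bigPos_ne_smallPos hq hk
  have h7 : bigPos b s p ≠ bigPos b s q := fun he => hne (h.bigPos_inj hp.1 hq.1 he)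
  unfold Far
  omega

end ConjugateCounts

theorem HComm.commMove {w w' : List Letter} (hw : Valid a b w) (hw' : Valid a b w')
    (h : HComm b w w') : CommMove (psi b w) (psi b w') := by
  cases h with
  | lowerLower p q hpq hr =>
    obtain ⟨s, t, rfl, rfl⟩ := hr
    have hs := hw.left.left
    have hp := hw.left.stepOK
    have hq := (sameCounts_concat_lower b s p).stepOK (valid_append_cons.1 hw.left).stepOK
    exact hs.commMove_psi hp hq ((hs.conjugateCounts.far_lower_lower hp hq).2 hpq)
  | upperUpper p q hpq hr =>
    obtain ⟨s, t, rfl, rfl⟩ := hr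
    have hs := hw.left.left
    have hp := hw.left.stepOK
    have hq := (sameCounts_concat_upper b s p).stepOK (valid_append_cons.1 hw.left).stepOK
    exact hs.commMove_psi hp hq ((hs.conjugateCounts.far_upper_upper hp hq).2 hpq)
  | plainPlain s t p q hpq hr hr' =>
    subst hr hr'
    have hs := hw.left.left
    have hp := hw.left.stepOK
    have hq := hw'.left.stepOK
    exact hs.commMove_psi hp hq (hs.conjugateCounts.far_plain_plain hp hq (by omega))
  | lowerUpper p q hr =>
    obtain ⟨s, t, rfl, rfl⟩ := hr
    have hs := hw.left.left
    have hp := hw.left.stepOK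
    have hq := hw'.left.stepOK
    exact hs.commMove_psi hp hq (hs.conjugateCounts.far_lower_upper hp hq)
  | lowerPlain p q hpq hr =>
    obtain ⟨s, t, rfl, rfl⟩ := hr
    have hs := hw.left.left
    have hp := hw.left.stepOK
    have hq := hw'.left.stepOK
    exact hs.commMove_psi hp hq ((hs.conjugateCounts.far_lower_plain hp hq).2 hpq)
  | upperPlain p q hpq hr =>
    obtain ⟨S, T, hr, hr'⟩ := hr
    -- The exchange happens in `f b w`, so the two letters of `w` are decoded first. An overlined
    -- letter leaves the counts alone, so the plain one can be read off after `s` itself.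
    obtain ⟨s, t, rfl, rfl, ht⟩ := exists_split_of_f_eq (hr.trans (List.append_assoc _ _ _))
    have hs := hw.left
    match t, ht with
    | c :: d :: t, ht =>
      simp only [fTail, List.cons_append, List.nil_append, List.cons.injEq] at ht
      obtain ⟨hc, hd, -⟩ := ht
      cases c <;> simp only [fStep, reduceCtorEq, upper.injEq] at hc
      subst hc
      rename_i p
      have hsame := sameCounts_concat_upper b s p
      rw [hsame.fStep_eq] at hd
      have hp := hw.stepOK
      have hx := hsame.stepOK (valid_append_cons.1 hw).stepOK
      cases d <;> simp only [fStep, reduceCtorEq, plain.injEq] at hd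
      subst hd
      rename_i x
      have hfar := (hs.conjugateCounts.far_upper_plain hp hx).2 hpq
      obtain ⟨hi, -, -⟩ := hs.interchangeable_of_far hp hx hfar
      obtain ⟨t', h1, rfl⟩ := hi.exists_of_f_eq hw hw' (T := T)
        (by rw [hr, f_append]; simp [fTail]) (by rw [hr', f_append]; simp [fTail])
      rw [h1]
      exact hs.commMove_psi hp hx hfar
    | [], ht => simp [fTail] at ht
    | [c], ht => simp [fTail] at ht

theorem Valid.hComm_of_far {s t : List Letter} (hs : Valid a b s) {c c' : Letter}
    (hc : StepOK a b s c) (hc' : StepOK a b s c') (hfar : Far (step b s c) (step b s c')) :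
    HComm b (s ++ [c, c'] ++ t) (s ++ [c', c] ++ t) ∨
      HComm b (s ++ [c', c] ++ t) (s ++ [c, c'] ++ t) := by
  have h := hs.conjugateCounts
  have hpu : ∀ {p q : ℕ}, StepOK a b s (upper p) → StepOK a b s (plain q) →
      Far (step b s (upper p)) (step b s (plain q)) →
      HComm b (s ++ [upper p, plain q] ++ t) (s ++ [plain q, upper p] ++ t) := by
    intro p q hp hq hfar
    obtain ⟨hi, -, -⟩ := hs.interchangeable_of_far hp hq hfar
    obtain ⟨T, h1, h2⟩ := hi.exists_f_eq t
    refine HComm.upperPlain p (b - N q s) ((h.far_upper_plain hp hq).1 hfar) ⟨f b s, T, ?_, ?_⟩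
    · rw [h1]
      simp [fTail]
    · rw [h2]
      simp [fTail]
  cases c with
  | plain p =>
    cases c' with
    | plain q =>
      rcases lt_trichotomy p q with hpq | rfl | hpq
      -- Taking the exchange in the direction that begins with the larger letter makes the first
      -- alternative of the side condition available.
      · exact Or.inr (HComm.plainPlain s t q p (Or.inl hpq) rfl rfl)
      · unfold Far at hfar
        omega
      · exact Or.inl (HComm.plainPlain s t p q (Or.inl hpq) rfl rfl)
    | lower q =>
      exact Or.inr (HComm.lowerPlain q p ((h.far_lower_plain hc' hc).1 hfar.symm) ⟨s, t, rfl, rfl⟩)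
    | upper q => exact Or.inr (hpu hc' hc hfar.symm)
  | lower p =>
    cases c' with
    | plain q =>
      exact Or.inl (HComm.lowerPlain p q ((h.far_lower_plain hc hc').1 hfar) ⟨s, t, rfl, rfl⟩)
    | lower q =>
      exact Or.inl (HComm.lowerLower p q ((h.far_lower_lower hc hc').1 hfar) ⟨s, t, rfl, rfl⟩)
    | upper q => exact Or.inl (HComm.lowerUpper p q ⟨s, t, rfl, rfl⟩)
  | upper p =>
    cases c' with
    | plain q => exact Or.inl (hpu hc hc' hfar)
    | lower q => exact Or.inr (HComm.lowerUpper q p ⟨s, t, rfl, rfl⟩)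
    | upper q =>
      exact Or.inl (HComm.upperUpper p q ((h.far_upper_upper hc hc').1 hfar) ⟨s, t, rfl, rfl⟩)

/-- Two valid words whose images under `psi` share a prefix and then differ: the next letters may
both follow the common prefix. -/
theorem Valid.exists_next_letters {w w' : List Letter} (hw : Valid a b w) (hw' : Valid a b w')
    {R T T' : List ℕ} {i i' : ℕ} (h : psi b w = R ++ i :: T) (h' : psi b w' = R ++ i' :: T') :
    ∃ s c c', Valid a b s ∧ psi b s = R ∧ (StepOK a b s c ∧ step b s c = i) ∧
      (StepOK a b s c' ∧ step b s c' = i') := by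
  obtain ⟨s, t, rfl, rfl, ht⟩ := exists_split_of_psi_eq h
  obtain ⟨s', t', rfl, hs', ht'⟩ := exists_split_of_psi_eq h'
  obtain rfl := hw'.left.psi_injective hw.left hs'
  match t, t', ht, ht' with
  | c :: t, c' :: t', ht, ht' =>
    simp only [psiTail, List.cons.injEq] at ht ht'
    exact ⟨s', c, c', hw.left, rfl, ⟨hw.stepOK, ht.1⟩, ⟨hw'.stepOK, ht'.1⟩⟩
  | [], _, ht, _ => simp [psiTail] at ht
  | _ :: _, [], _, ht' => simp [psiTail] at ht'

theorem Valid.hComm_of_commMove {w w' : List Letter} (hw : Valid a b w) (hw' : Valid a b w')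
    (h : CommMove (psi b w) (psi b w')) : HComm b w w' ∨ HComm b w' w := by
  obtain ⟨R, T, i, i', hfar, h1, h2⟩ := h
  obtain ⟨s, c, c', hs, rfl, ⟨hc, rfl⟩, ⟨hc', rfl⟩⟩ := hw.exists_next_letters hw'
    (by simpa using h1) (by simpa using h2)
  obtain ⟨hi, h3, h4⟩ := hs.interchangeable_of_far hc hc' hfar
  obtain ⟨t, rfl, rfl⟩ := hi.exists_of_psi_eq hw hw' (T := T) (by rw [h1, psi_append, h3])
    (by rw [h2, psi_append, h4])
  exact hs.hComm_of_far hc hc' hfar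

/-! Long braid moves -/

theorem Valid.triple {s : List Letter} (hs : Valid a b s) {c d e : Letter} {i j k : ℕ}
    (hc : StepOK a b s c ∧ step b s c = i)
    (hd : StepOK a b (s ++ [c]) d ∧ step b (s ++ [c]) d = j)
    (he : StepOK a b (s ++ [c] ++ [d]) e ∧ step b (s ++ [c] ++ [d]) e = k) :
    Valid a b (s ++ [c, d, e]) ∧ psiTail b s [c, d, e] = [i, j, k] := by
  refine ⟨?_, ?_⟩
  · rw [valid_append_cons, valid_append_cons, valid_concat, valid_concat, valid_concat]
    exact ⟨⟨⟨hs, hc.1⟩, hd.1⟩, he.1⟩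
  · simp only [psiTail, hc.2, hd.2, he.2]

/-- Underlined letters do not change the counts, so both letters stay available, with the same
images, throughout the three steps. -/
theorem Valid.braid_lower {s : List Letter} (hs : Valid a b s) {p i : ℕ}
    (hp : 1 ≤ p ∧ p + 1 < a) (h0 : bigPos b s p = i) (h1 : bigPos b s (p + 1) = i + 1)
    (h2 : bigPos b s (p + 2) = i + 2) :
    Interchangeable a b s [lower p, lower (p + 1), lower p]
        [lower (p + 1), lower p, lower (p + 1)] ∧
      psiTail b s [lower p, lower (p + 1), lower p] = [i, i + 1, i] ∧
      psiTail b s [lower (p + 1), lower p, lower (p + 1)] = [i + 1, i, i + 1] := by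
  have hstep : ∀ {t : List Letter}, SameCounts b s t →
      (StepOK a b t (lower p) ∧ step b t (lower p) = i) ∧
      (StepOK a b t (lower (p + 1)) ∧ step b t (lower (p + 1)) = i + 1) := by
    intro t ht
    have h3 := hs.conjugateCounts.stepOK_lower_iff.2 ⟨⟨hp.1, by omega⟩, h0, h1⟩
    have h4 := hs.conjugateCounts.stepOK_lower_iff.2 ⟨⟨by omega, hp.2⟩, h1, h2⟩
    exact ⟨⟨ht.stepOK h3.1, ht.step_eq _ ▸ h3.2⟩, ⟨ht.stepOK h4.1, ht.step_eq _ ▸ h4.2⟩⟩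
  have hsame : ∀ p, SameCounts b s (s ++ [lower p]) := fun p =>
    (sameCounts_concat_lower b s p).symm
  have hsame2 : ∀ p q, SameCounts b s (s ++ [lower p] ++ [lower q]) := fun p q j => by
    simp [-List.append_assoc, f_concat]
  have hrefl : SameCounts b s s := fun j => ⟨rfl, rfl⟩
  obtain ⟨hl, hl'⟩ := hs.triple (hstep hrefl).1 (hstep (hsame p)).2 (hstep (hsame2 p (p + 1))).1
  obtain ⟨hr, hr'⟩ := hs.triple (hstep hrefl).2 (hstep (hsame (p + 1))).1
    (hstep (hsame2 (p + 1) p)).2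
  exact ⟨⟨hl, hr, fun j => by simp [N]⟩, hl', hr'⟩

theorem Valid.braid_upper {s : List Letter} (hs : Valid a b s) {p i : ℕ}
    (hp : 1 ≤ p ∧ p + 1 < b) (h0 : smallPos b s p = i) (h1 : smallPos b s (p + 1) = i + 1)
    (h2 : smallPos b s (p + 2) = i + 2) :
    Interchangeable a b s [upper p, upper (p + 1), upper p]
        [upper (p + 1), upper p, upper (p + 1)] ∧
      psiTail b s [upper p, upper (p + 1), upper p] = [i, i + 1, i] ∧
      psiTail b s [upper (p + 1), upper p, upper (p + 1)] = [i + 1, i, i + 1] := by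
  have hstep : ∀ {t : List Letter}, SameCounts b s t →
      (StepOK a b t (upper p) ∧ step b t (upper p) = i) ∧
      (StepOK a b t (upper (p + 1)) ∧ step b t (upper (p + 1)) = i + 1) := by
    intro t ht
    have h3 := (stepOK_upper_iff (a := a)).2 ⟨⟨hp.1, by omega⟩, h0, h1⟩
    have h4 := (stepOK_upper_iff (a := a)).2 ⟨⟨by omega, hp.2⟩, h1, h2⟩
    exact ⟨⟨ht.stepOK h3.1, ht.step_eq _ ▸ h3.2⟩, ⟨ht.stepOK h4.1, ht.step_eq _ ▸ h4.2⟩⟩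
  have hsame : ∀ p, SameCounts b s (s ++ [upper p]) := fun p =>
    (sameCounts_concat_upper b s p).symm
  have hsame2 : ∀ p q, SameCounts b s (s ++ [upper p] ++ [upper q]) := fun p q j => by
    simp [-List.append_assoc, f_concat]
  have hrefl : SameCounts b s s := fun j => ⟨rfl, rfl⟩
  obtain ⟨hl, hl'⟩ := hs.triple (hstep hrefl).1 (hstep (hsame p)).2 (hstep (hsame2 p (p + 1))).1
  obtain ⟨hr, hr'⟩ := hs.triple (hstep hrefl).2 (hstep (hsame (p + 1))).1
    (hstep (hsame2 (p + 1) p)).2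
  exact ⟨⟨hl, hr, fun j => by simp [N]⟩, hl', hr'⟩

/-- One small value followed by two large values. -/
theorem Valid.braid_lower_plain {s : List Letter} (hs : Valid a b s) {p k i : ℕ}
    (hp : 1 ≤ p ∧ p < a) (hk : 1 ≤ k ∧ k ≤ b) (h0 : smallPos b s k = i)
    (h1 : bigPos b s p = i + 1) (h2 : bigPos b s (p + 1) = i + 2) :
    Interchangeable a b s [plain p, plain (p + 1), lower p] [lower p, plain p, plain (p + 1)] ∧
      psiTail b s [plain p, plain (p + 1), lower p] = [i, i + 1, i] ∧
      psiTail b s [lower p, plain p, plain (p + 1)] = [i + 1, i, i + 1] := by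
  have h := hs.conjugateCounts
  obtain ⟨hx, hxi, hxk⟩ := h.stepOK_plain_iff.2 ⟨⟨hp.1, hp.2.le⟩, hk, h0, h1⟩
  have hs1 := valid_concat.2 ⟨hs, hx⟩
  have hb1 : bigPos b (s ++ [plain p]) (p + 1) = i + 1 + 1 := by simp [h2]
  have hk1 : smallPos b (s ++ [plain p]) k = i + 1 := by simp [hxk, h0]
  obtain ⟨hy, hyi, hyk⟩ := hs1.conjugateCounts.stepOK_plain_iff.2 ⟨⟨by omega, hp.2⟩, hk, hk1, hb1⟩
  have hs2 := valid_concat.2 ⟨hs1, hy⟩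
  have hl := hs2.conjugateCounts.stepOK_lower_iff (p := p) (i := i) |>.2
    ⟨hp, by simp [-List.append_assoc, h1], by simp [-List.append_assoc, h2]⟩
  obtain ⟨hl, hl'⟩ := hs.triple ⟨hx, hxi⟩ ⟨hy, hyi⟩ hl
  have hu := h.stepOK_lower_iff (p := p) (i := i + 1) |>.2 ⟨hp, h1, h2⟩
  have ht1 := valid_concat.2 ⟨hs, hu.1⟩
  obtain ⟨hv, hvi, hvk⟩ := ht1.conjugateCounts.stepOK_plain_iff (p := p) (k := k) (i := i) |>.2
    ⟨⟨hp.1, hp.2.le⟩, hk, by simp [h0], by simp [h1]⟩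
  have ht2 := valid_concat.2 ⟨ht1, hv⟩
  obtain ⟨hw, hwi, -⟩ := ht2.conjugateCounts.stepOK_plain_iff (p := p + 1) (k := k) (i := i + 1)
    |>.2 ⟨⟨by omega, hp.2⟩, hk, by rw [smallPos_concat_plain, if_pos hvk]; simp [h0],
      by simp [-List.append_assoc, h2]⟩
  obtain ⟨hr, hr'⟩ := hs.triple hu ⟨hv, hvi⟩ ⟨hw, hwi⟩
  exact ⟨⟨hl, hr, fun j => by simp [N, List.count_cons]⟩, hl', hr'⟩

/-- Two small values followed by one large value. -/
theorem Valid.braid_upper_plain {s : List Letter} (hs : Valid a b s) {x k i : ℕ}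
    (hx : 1 ≤ x ∧ x ≤ a) (hk : 1 ≤ k ∧ k < b) (h0 : smallPos b s k = i)
    (h1 : smallPos b s (k + 1) = i + 1) (h2 : bigPos b s x = i + 2) :
    Interchangeable a b s [upper k, plain x, plain x] [plain x, plain x, upper k] ∧
      psiTail b s [upper k, plain x, plain x] = [i, i + 1, i] ∧
      psiTail b s [plain x, plain x, upper k] = [i + 1, i, i + 1] ∧
      fTail b s [upper k, plain x, plain x] = [upper k, plain (k + 1), plain k] ∧
      fTail b s [plain x, plain x, upper k] = [plain (k + 1), plain k, upper k] := by
  have h := hs.conjugateCounts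
  -- The `x`-th large value passes the small values `k + 1` and `k` in this order: a repeated `x` in
  -- `w` appears as `k + 1, k` under `f`.
  have hu := (stepOK_upper_iff (a := a)).2 ⟨hk, h0, h1⟩
  have hs1 := valid_concat.2 ⟨hs, hu.1⟩
  obtain ⟨hy, hyi, hyk⟩ := hs1.conjugateCounts.stepOK_plain_iff (p := x) (k := k + 1) (i := i + 1)
    |>.2 ⟨hx, ⟨by omega, hk.2⟩, by simp [h1], by simp [h2]⟩
  have hs2 := valid_concat.2 ⟨hs1, hy⟩
  obtain ⟨hz, hzi, hzk⟩ := hs2.conjugateCounts.stepOK_plain_iff (p := x) (k := k) (i := i)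
    |>.2 ⟨hx, ⟨hk.1, hk.2.le⟩, by rw [smallPos_concat_plain, if_neg (by omega)]; simp [h0],
      by simp [-List.append_assoc, h2]⟩
  obtain ⟨hl, hl'⟩ := hs.triple hu ⟨hy, hyi⟩ ⟨hz, hzi⟩
  obtain ⟨hv, hvi, hvk⟩ := h.stepOK_plain_iff (p := x) (k := k + 1) (i := i + 1)
    |>.2 ⟨hx, ⟨by omega, hk.2⟩, h1, h2⟩
  have ht1 := valid_concat.2 ⟨hs, hv⟩
  obtain ⟨hw, hwi, hwk⟩ := ht1.conjugateCounts.stepOK_plain_iff (p := x) (k := k) (i := i)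
    |>.2 ⟨hx, ⟨hk.1, hk.2.le⟩, by rw [smallPos_concat_plain, if_neg (by omega), h0],
      by simp [h2]⟩
  have ht2 := valid_concat.2 ⟨ht1, hw⟩
  have hr := (stepOK_upper_iff (a := a) (b := b) (s := s ++ [plain x] ++ [plain x]) (p := k)
    (i := i + 1)).2 ⟨hk, by
      rw [smallPos_concat_plain, if_pos hwk, smallPos_concat_plain, if_neg (by omega), h0], by
      rw [smallPos_concat_plain, if_neg (by omega), smallPos_concat_plain, if_pos hvk, h1]⟩
  obtain ⟨hr, hr'⟩ := hs.triple ⟨hv, hvi⟩ ⟨hw, hwi⟩ hr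
  refine ⟨⟨hl, hr, fun j => by simp [N, List.count_cons]⟩, hl', hr', ?_, ?_⟩
  · simp only [fTail, fStep, hyk, hzk]
  · simp only [fTail, fStep, hvk, hwk]

theorem Interchangeable.braidMove {s q q' t : List Letter} {i : ℕ}
    (h : Interchangeable a b s q q') (hq : psiTail b s q = [i, i + 1, i])
    (hq' : psiTail b s q' = [i + 1, i, i + 1]) :
    BraidMove (psi b (s ++ q ++ t)) (psi b (s ++ q' ++ t)) := by
  obtain ⟨T, h1, h2⟩ := h.exists_psi_eq t
  exact ⟨psi b s, T, i, by rw [h1, hq], by rw [h2, hq']⟩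

theorem HBraid.braidMove {w w' : List Letter} (hw : Valid a b w) (hw' : Valid a b w')
    (h : HBraid b w w') : BraidMove (psi b w) (psi b w') ∨ BraidMove (psi b w') (psi b w) := by
  cases h with
  | lowerLower p hr =>
    obtain ⟨s, t, rfl, rfl⟩ := hr
    have hs := hw.left.left
    obtain ⟨hp, h0, h1⟩ := hs.conjugateCounts.stepOK_lower_iff.1 ⟨hw.left.stepOK, rfl⟩
    obtain ⟨hq, h2, h3⟩ := hs.conjugateCounts.stepOK_lower_iff.1 ⟨hw'.left.stepOK, rfl⟩
    obtain ⟨hi, h4, h5⟩ := hs.braid_lower ⟨hp.1, hq.2⟩ h0 h1 (by rw [h3, ← h2, h1])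
    exact Or.inl (hi.braidMove h4 h5)
  | upperUpper p hr =>
    obtain ⟨s, t, rfl, rfl⟩ := hr
    have hs := hw.left.left
    obtain ⟨hp, h0, h1⟩ := stepOK_upper_iff.1 ⟨hw.left.stepOK, rfl⟩
    obtain ⟨hq, h2, h3⟩ := stepOK_upper_iff.1 ⟨hw'.left.stepOK, rfl⟩
    obtain ⟨hi, h4, h5⟩ := hs.braid_upper ⟨hp.1, hq.2⟩ h0 h1 (by rw [h3, ← h2, h1])
    exact Or.inl (hi.braidMove h4 h5)
  | lowerPlain p hr =>
    obtain ⟨s, t, rfl, rfl⟩ := hr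
    have hs := hw.left.left
    obtain ⟨hp, h0, h1⟩ := hs.conjugateCounts.stepOK_lower_iff.1 ⟨hw.left.stepOK, rfl⟩
    obtain ⟨hq, hk, h2, h3⟩ := hs.conjugateCounts.stepOK_plain_iff.1 ⟨hw'.left.stepOK, rfl, rfl⟩
    obtain ⟨hi, h4, h5⟩ := hs.braid_lower_plain hp hk h2 h3 (by rw [h1, ← h0, h3])
    -- The word that begins with the underlined letter has the image `i + 1, i, i + 1`, hence the
    -- reversed direction.
    exact Or.inr (hi.braidMove h4 h5)
  | upperPlain p hr =>
    obtain ⟨S, T, hr, hr'⟩ := hr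
    obtain ⟨s, t, rfl, rfl, ht⟩ := exists_split_of_f_eq (hr.trans (List.append_assoc _ _ _))
    have hs := hw.left
    match t, ht with
    | c :: d :: t, ht =>
      simp only [fTail, List.cons_append, List.nil_append, List.cons.injEq] at ht
      obtain ⟨hc, hd, -⟩ := ht
      cases c <;> simp only [fStep, reduceCtorEq, upper.injEq] at hc
      subst hc
      rename_i p
      have hsame := sameCounts_concat_upper b s p
      rw [hsame.fStep_eq] at hd
      have hx := hsame.stepOK (valid_append_cons.1 hw).stepOK
      cases d <;> simp only [fStep, reduceCtorEq, plain.injEq] at hd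
      rename_i x
      obtain ⟨hp, h0, h1⟩ := stepOK_upper_iff.1 ⟨hw.stepOK, rfl⟩
      obtain ⟨hx, hk, h2, h3⟩ := hs.conjugateCounts.stepOK_plain_iff.1 ⟨hx, rfl, hd⟩
      -- The first two decoded letters already locate the three values: small `p`, small `p + 1` and
      -- large `x` on consecutive positions.
      obtain ⟨hi, h4, h5, h6, h7⟩ := hs.braid_upper_plain hx hp h0 h1 (by rw [h3, ← h2, h1])
      obtain ⟨t', h8, rfl⟩ := hi.exists_of_f_eq hw hw' (T := T)
        (by rw [hr, f_append, h6]) (by rw [hr', f_append, h7])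
      rw [h8]
      exact Or.inl (hi.braidMove h4 h5)
    | [], ht => simp [fTail] at ht
    | [c], ht => simp [fTail] at ht

/-- After the common prefix, one word continues with a letter acting at `i` and the other with one
acting at `i + 1`, so three consecutive positions are described. The two letters must agree on the
kind of the middle value. This leaves large-large-large, small-small-small, small-large-large and
small-small-large, one for each long braid move. -/
theorem Valid.hBraid_of_braidMove {w w' : List Letter} (hw : Valid a b w) (hw' : Valid a b w')
    (h : BraidMove (psi b w) (psi b w')) : HBraid b w w' ∨ HBraid b w' w := by
  obtain ⟨R, T, i, h1, h2⟩ := h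
  obtain ⟨s, c, c', hs, rfl, hc, hc'⟩ := hw.exists_next_letters hw'
    (by simpa using h1) (by simpa using h2)
  have h := hs.conjugateCounts
  have key : ∀ {q q' : List Letter}, Interchangeable a b s q q' →
      psiTail b s q = [i, i + 1, i] → psiTail b s q' = [i + 1, i, i + 1] →
      ∃ t, w = s ++ q ++ t ∧ w' = s ++ q' ++ t := fun hi hq hq' =>
    hi.exists_of_psi_eq hw hw' (T := T) (by rw [h1, psi_append, hq]) (by rw [h2, psi_append, hq'])
  cases c with
  | plain p =>
    obtain ⟨hp, hk, h3, h4⟩ := h.stepOK_plain_iff.1 ⟨hc.1, hc.2, rfl⟩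
    cases c' with
    | plain q =>
      obtain ⟨-, hk', h5, -⟩ := h.stepOK_plain_iff.1 ⟨hc'.1, hc'.2, rfl⟩
      exact absurd (h4.trans h5.symm) (h.bigPos_ne_smallPos hp hk')
    | lower q =>
      obtain ⟨hq, h5, h6⟩ := h.stepOK_lower_iff.1 hc'
      obtain rfl := h.bigPos_inj hq.1 hp.1 (h5.trans h4.symm)
      obtain ⟨hi, h7, h8⟩ := hs.braid_lower_plain hq hk h3 h4 h6
      obtain ⟨t, rfl, rfl⟩ := key hi h7 h8
      exact Or.inr (HBraid.lowerPlain q ⟨s, t, rfl, rfl⟩)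
    | upper q =>
      obtain ⟨hq, h5, -⟩ := stepOK_upper_iff.1 hc'
      exact absurd (h4.trans h5.symm) (h.bigPos_ne_smallPos hp (by omega))
  | lower p =>
    obtain ⟨hp, h3, h4⟩ := h.stepOK_lower_iff.1 hc
    cases c' with
    | plain q =>
      obtain ⟨-, hk', h5, -⟩ := h.stepOK_plain_iff.1 ⟨hc'.1, hc'.2, rfl⟩
      exact absurd (h4.trans h5.symm) (h.bigPos_ne_smallPos (by omega) hk')
    | lower q =>
      obtain ⟨hq, h5, h6⟩ := h.stepOK_lower_iff.1 hc'
      obtain rfl := h.bigPos_inj hq.1 (by omega) (h5.trans h4.symm)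
      obtain ⟨hi, h7, h8⟩ := hs.braid_lower ⟨hp.1, hq.2⟩ h3 h4 h6
      obtain ⟨t, rfl, rfl⟩ := key hi h7 h8
      exact Or.inl (HBraid.lowerLower p ⟨s, t, rfl, rfl⟩)
    | upper q =>
      obtain ⟨hq, h5, -⟩ := stepOK_upper_iff.1 hc'
      exact absurd (h4.trans h5.symm) (h.bigPos_ne_smallPos (by omega) (by omega))
  | upper p =>
    obtain ⟨hp, h3, h4⟩ := stepOK_upper_iff.1 hc
    cases c' with
    | plain q =>
      obtain ⟨hq, hk', h5, h6⟩ := h.stepOK_plain_iff.1 ⟨hc'.1, hc'.2, rfl⟩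
      obtain ⟨hi, h7, h8, h9, h10⟩ := hs.braid_upper_plain hq hp h3 h4 h6
      obtain ⟨t, rfl, rfl⟩ := key hi h7 h8
      obtain ⟨T, h11, h12⟩ := hi.exists_f_eq t
      exact Or.inl (HBraid.upperPlain p ⟨f b s, T, by rw [h11, h9], by rw [h12, h10]⟩)
    | lower q =>
      obtain ⟨hq, h5, -⟩ := h.stepOK_lower_iff.1 hc'
      exact absurd (h5.trans h4.symm) (h.bigPos_ne_smallPos (by omega) (by omega))
    | upper q =>
      obtain ⟨hq, h5, h6⟩ := stepOK_upper_iff.1 hc'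
      obtain rfl := h.smallPos_inj (by omega) (by omega) (h5.trans h4.symm)
      obtain ⟨hi, h7, h8⟩ := hs.braid_upper ⟨hp.1, hq.2⟩ h3 h4 h6
      obtain ⟨t, rfl, rfl⟩ := key hi h7 h8
      exact Or.inl (HBraid.upperUpper p ⟨s, t, rfl, rfl⟩)

/-! The graph isomorphism -/

theorem Valid.moves_iff {w w' : List Letter} (hw : Valid a b w) (hw' : Valid a b w') :
    ((CommMove (psi b w) (psi b w') ∨ BraidMove (psi b w) (psi b w')) ∨
        (CommMove (psi b w') (psi b w) ∨ BraidMove (psi b w') (psi b w))) ↔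
      ((HComm b w w' ∨ HBraid b w w') ∨ (HComm b w' w ∨ HBraid b w' w)) := by
  constructor
  · rintro ((h | h) | (h | h))
    · have := hw.hComm_of_commMove hw' h
      tauto
    · have := hw.hBraid_of_braidMove hw' h
      tauto
    · have := hw'.hComm_of_commMove hw h
      tauto
    · have := hw'.hBraid_of_braidMove hw h
      tauto
  · rintro ((h | h) | (h | h))
    · exact Or.inl (Or.inl (h.commMove hw hw'))
    · have := h.braidMove hw hw'
      tauto
    · exact Or.inr (Or.inl (h.commMove hw' hw))
    · have := h.braidMove hw' hw
      tauto

theorem psi_graph_iso (α : Perm (Fin a)) (β : Perm (Fin b)) :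
    ∃ φ : graphH α β ≃g graphG (inflation21 α β),
      ∀ w : vertexSet α β, (φ w : List ℕ) = psi b (w : List Letter) := by
  have hbij := psi_bijOn α β
  refine ⟨⟨hbij.equiv _, fun {w w'} => ?_⟩, fun w => rfl⟩
  have hw := (mem_vertexSet_iff.1 w.2).1
  have hw' := (mem_vertexSet_iff.1 w'.2).1
  rw [graphG, graphH, SimpleGraph.fromRel_adj, SimpleGraph.fromRel_adj]
  exact and_congr (hbij.equiv _).injective.ne_iff (hw.moves_iff hw')

end Inflation21

theorem theorem4p2 (a b : ℕ) (α : Equiv.Perm (Fin a)) (β : Equiv.Perm (Fin b)) :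
    Set.BijOn (Inflation21.psi b) (Inflation21.vertexSet α β)
      (Inflation21.reducedWords (Inflation21.inflation21 α β)) ∧
    ∃ φ : Inflation21.graphH α β ≃g Inflation21.graphG (Inflation21.inflation21 α β),
      ∀ w : Inflation21.vertexSet α β, (φ w : List ℕ) = Inflation21.psi b (w : List Inflation21.Letter) :=
  ⟨Inflation21.psi_bijOn α β, Inflation21.psi_graph_iso α β⟩
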